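/- Conventions. All systems are finite-dimensional. Alice holds a system $\mathcal A$, Bob a system $\mathcal B$. The squared Schmidt coefficients of a pure state $\psi\in\mathcal A\otimes\mathcal B$ are the eigenvalues of its reduced state on $\mathcal B$, and $\lambda_{\max}(\psi)$ is the largest one. An LOCC protocol is an adaptive protocol with finitely many rounds, in each of which one party applies a quantum instrument (with finitely many outcomes, and possibly adjoining ancillas or discarding subsystems) to its own system and announces the outcome; at the end the parties accept or abort. It converts $\psi$ into a Bell pair with probability $p$ if it accepts with probability $p$ and, when $p>0$, the state conditioned on acceptance has marginal $|\Phi^+\rangle\langle\Phi^+|$, $|\Phi^+\rangle=(|00\rangle+|11\rangle)/\sqrt2$, on a qubit $A$ of Alice and a qubit $B$ of Bob (the leftover, or junk, systems being arbitrary). $P_{\max}(\psi)$ is the maximum of these $p$. (1) For every unit vector $\psi\in\mathcal A\otimes\mathcal B$ the maximum is attained and $$P_{\max}(\psi)=\min\bigl(1,\,2(1-\lambda_{\max}(\psi))\bigr).$$ For every prescribed product junk state $|x\rangle\otimes|y\rangle$ ($x$ with Alice, $y$ with Bob), the same number is also the maximal LOCC probability of converting $\psi$ into the pure state $|\Phi^+\rangle_{AB}\otimes|x\rangle\otimes|y\rangle$.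 Assistance. Let $0<\theta\le\pi/4$. The link is $\cos\theta|00\rangle_{AB}+\sin\theta|11\rangle_{AB}$, and a third party, the Bank, supplies a three-qubit state $\Omega_{A'B'K}$; $A,A'$ are with Alice, $B,B'$ with Bob, $K$ with the Bank. In the transfer model $K$ is given to Alice and the state is viewed across $AA'K\mid BB'$. In the Bank-measures model the Bank performs a rank-one measurement $\{|e_m\rangle\langle e_m|\}$ (a finite POVM) on $K$ and broadcasts $m$, after which Alice and Bob apply an LOCC protocol, which may depend on $m$, to the resulting pure state across $AA'\mid BB'$; the Hadamard measurement is that in the basis $|\pm\rangle=(|0\rangle\pm|1\rangle)/\sqrt2$. (2) Let $\Omega=\alpha|000\rangle+\beta|111\rangle$ with $\alpha\ge\beta>0$ and $\alpha^2+\beta^2=1$. In the transfer model, and in each of the two outcomes (each of probability $1/2$) of the Hadamard measurement, $\lambda_{\max}=\alpha^2\cos^2\theta$ and $$P_{\max}^{\rm GHZ}=\min\bigl(1,\,2(1-\alpha^2\cos^2\theta)\bigr).$$ This is also the maximal total success probability when the Bank uses the Hadamard measurement, and no other rank-one measurement of the Bank gives a larger one. (3) Let $\Omega=\alpha|001\rangle+\beta|010\rangle+\gamma|100\rangle$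 with $\alpha,\beta,\gamma>0$ and $\alpha^2+\beta^2+\gamma^2=1$. In each of the two outcomes (each of probability $1/2$) of the Hadamard measurement, $\lambda_{\max}=\tfrac12\cos^2\theta\,(1+\sqrt{1-4\beta^2\gamma^2})$ and $$P_{\max}^{\rm W,meas}=\min\Bigl(1,\,2-\cos^2\theta\bigl(1+\sqrt{1-4\beta^2\gamma^2}\bigr)\Bigr),$$ which is also the maximal total success probability when the Bank uses the Hadamard measurement; it equals $1$ if and only if $4\beta^2\gamma^2\ge 1-\tan^4\theta$. In the transfer model $\lambda_{\max}=\cos^2\theta\,\max(\beta^2,1-\beta^2)$ and $$P_{\max}^{\rm W,trans}=\min\Bigl(1,\,2\bigl(1-\cos^2\theta\,\max(\beta^2,1-\beta^2)\bigr)\Bigr).$$ -/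

import Mathlib

open scoped Kronecker

noncomputable section

namespace BellRestoration

/-! Alice's register has computational basis `a`, Bob's has `b` (finite types).  A pure state of the
two is a vector of `EuclideanSpace ℂ (a × b)`, and a (possibly unnormalised) mixed state is a matrix
indexed by `a × b`. -/

/-- The operator `|ψ⟩⟨ψ|`. -/
def pureOp {n : Type} (ψ : EuclideanSpace ℂ n) : Matrix n n ℂ :=
  Matrix.of fun i j => ψ i * star (ψ j)

/-- The matrix of coefficients of a bipartite vector, with rows indexed by Bob's basis. -/
def coeffMatrix {a b : Type} (ψ : EuclideanSpace ℂ (a × b)) : Matrix b a ℂ :=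
  Matrix.of fun j i => ψ (i, j)

/-- The reduced state of Bob, `Tr_Alice |ψ⟩⟨ψ|`. -/
def reducedBob {a b : Type} [Fintype a] (ψ : EuclideanSpace ℂ (a × b)) : Matrix b b ℂ :=
  coeffMatrix ψ * (coeffMatrix ψ).conjTranspose

theorem reducedBob_isHermitian {a b : Type} [Fintype a] (ψ : EuclideanSpace ℂ (a × b)) :
    (reducedBob ψ).IsHermitian :=
  Matrix.isHermitian_mul_conjTranspose_self _

/-- The squared Schmidt coefficients of `ψ` across Alice | Bob (padded by zeros): the eigenvalues,
with multiplicity, of Bob's reduced state. -/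
def schmidtSq {a b : Type} [Fintype a] [Fintype b] [DecidableEq b]
    (ψ : EuclideanSpace ℂ (a × b)) : b → ℝ :=
  (reducedBob_isHermitian ψ).eigenvalues

/-- The largest squared Schmidt coefficient. -/
def lambdaMax {a b : Type} [Fintype a] [Fintype b] [DecidableEq b]
    (ψ : EuclideanSpace ℂ (a × b)) : ℝ :=
  ⨆ j, schmidtSq ψ j

/-- `ρ ↦ (K ⊗ 1) ρ (K ⊗ 1)†`, for an operator `K` from Alice's register to a new one. -/
def onAlice {a a' b : Type} [Fintype a] [Fintype b] [DecidableEq b]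
    (K : Matrix a' a ℂ) (ρ : Matrix (a × b) (a × b) ℂ) : Matrix (a' × b) (a' × b) ℂ :=
  (K ⊗ₖ (1 : Matrix b b ℂ)) * ρ * (K ⊗ₖ (1 : Matrix b b ℂ)).conjTranspose

/-- `ρ ↦ (1 ⊗ K) ρ (1 ⊗ K)†`, for an operator `K` from Bob's register to a new one. -/
def onBob {a b b' : Type} [Fintype a] [DecidableEq a] [Fintype b]
    (K : Matrix b' b ℂ) (ρ : Matrix (a × b) (a × b) ℂ) : Matrix (a × b') (a × b') ℂ :=
  ((1 : Matrix a a ℂ) ⊗ₖ K) * ρ * ((1 : Matrix a a ℂ) ⊗ₖ K).conjTranspose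

/-- `LOCC c d a b F`: there is a finite-round LOCC protocol which starts on the registers `a | b`,
at whose end Alice and Bob either abort or accept and then hold the registers `c | d`, such that
`F` maps the initial state to the unnormalised state on acceptance (so that the trace of `F ρ` is
the probability of acceptance).

In one step a party performs a quantum instrument on its own register: outcome `i` has the Kraus
operators `K i k`, and may lead to a register of another dimension, so that ancillas can be adjoined
and subsystems discarded.  The outcome `i` is announced, and the remaining protocol depends on it;
the index `k` is forgotten. -/
inductive LOCC (c d : Type) [Fintype c] [DecidableEq c] [Fintype d] [DecidableEq d] :
    (a b : Type) → [Fintype a] → [DecidableEq a] → [Fintype b] → [DecidableEq b] →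
    (Matrix (a × b) (a × b) ℂ → Matrix (c × d) (c × d) ℂ) → Prop
  | accept : LOCC c d c d (fun ρ => ρ)
  | abort {a b : Type} [Fintype a] [DecidableEq a] [Fintype b] [DecidableEq b] :
      LOCC c d a b (fun _ => 0)
  | alice {a b : Type} [Fintype a] [DecidableEq a] [Fintype b] [DecidableEq b]
      {ι : Type} [Fintype ι] {κ : ι → Type} [∀ i, Fintype (κ i)]
      {a' : ι → Type} [∀ i, Fintype (a' i)] [∀ i, DecidableEq (a' i)]
      (K : ∀ i, κ i → Matrix (a' i) a ℂ)
      (complete : ∑ i, ∑ k, (K i k).conjTranspose * K i k = 1)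
      (F : ∀ i, Matrix (a' i × b) (a' i × b) ℂ → Matrix (c × d) (c × d) ℂ)
      (next : ∀ i, LOCC c d (a' i) b (F i)) :
      LOCC c d a b (fun ρ => ∑ i, F i (∑ k, onAlice (K i k) ρ))
  | bob {a b : Type} [Fintype a] [DecidableEq a] [Fintype b] [DecidableEq b]
      {ι : Type} [Fintype ι] {κ : ι → Type} [∀ i, Fintype (κ i)]
      {b' : ι → Type} [∀ i, Fintype (b' i)] [∀ i, DecidableEq (b' i)]
      (K : ∀ i, κ i → Matrix (b' i) b ℂ)
      (complete : ∑ i, ∑ k, (K i k).conjTranspose * K i k = 1)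
      (F : ∀ i, Matrix (a × b' i) (a × b' i) ℂ → Matrix (c × d) (c × d) ℂ)
      (next : ∀ i, LOCC c d a (b' i) (F i)) :
      LOCC c d a b (fun ρ => ∑ i, F i (∑ k, onBob (K i k) ρ))

/-- The probabilities with which LOCC protocols convert the pure state `ψ` into the pure
state `φ`. -/
def conversionProbs {a b c d : Type} [Fintype a] [DecidableEq a] [Fintype b] [DecidableEq b]
    [Fintype c] [DecidableEq c] [Fintype d] [DecidableEq d]
    (ψ : EuclideanSpace ℂ (a × b)) (φ : EuclideanSpace ℂ (c × d)) : Set ℝ :=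
  {p | ∃ F, LOCC c d a b F ∧ F (pureOp ψ) = (p : ℂ) • pureOp φ}

/-- The Bell state `(|00⟩ + |11⟩)/√2`. -/
def bell : EuclideanSpace ℂ (Fin 2 × Fin 2) :=
  WithLp.toLp 2 fun i => if i.1 = i.2 then ((1 / √2 : ℝ) : ℂ) else 0

/-- `|Φ⁺⟩ ⊗ |x⟩ ⊗ |y⟩`: a Bell pair on the qubits of Alice and Bob, with a leftover (junk) state `x`
of Alice and `y` of Bob. -/
def bellWithJunk {ja jb : Type} (x : EuclideanSpace ℂ ja) (y : EuclideanSpace ℂ jb) :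
    EuclideanSpace ℂ ((Fin 2 × ja) × (Fin 2 × jb)) :=
  WithLp.toLp 2 fun i => bell (i.1.1, i.2.1) * (x i.1.2 * y i.2.2)

/-- Discarding the junk registers `ja` of Alice and `jb` of Bob: the partial trace onto the two
qubits. -/
def discardJunk {ja jb : Type} [Fintype ja] [Fintype jb]
    (σ : Matrix ((Fin 2 × ja) × (Fin 2 × jb)) ((Fin 2 × ja) × (Fin 2 × jb)) ℂ) :
    Matrix (Fin 2 × Fin 2) (Fin 2 × Fin 2) ℂ :=
  Matrix.of fun i j => ∑ x, ∑ y, σ ((i.1, x), (i.2, y)) ((j.1, x), (j.2, y))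

/-- The probabilities with which LOCC protocols convert `ψ` into a perfect Bell pair on a qubit of
Alice and a qubit of Bob, with arbitrary (possibly mixed or entangled) leftover systems.  If `ψ` is
not normalised, these are multiplied by `‖ψ‖ ^ 2`. -/
def bellProbs {a b : Type} [Fintype a] [DecidableEq a] [Fintype b] [DecidableEq b]
    (ψ : EuclideanSpace ℂ (a × b)) : Set ℝ :=
  {p | ∃ (ja jb : Type) (_ : Fintype ja) (_ : DecidableEq ja) (_ : Fintype jb)
      (_ : DecidableEq jb)
      (F : Matrix (a × b) (a × b) ℂ →
        Matrix ((Fin 2 × ja) × (Fin 2 × jb)) ((Fin 2 × ja) × (Fin 2 × jb)) ℂ),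
      LOCC (Fin 2 × ja) (Fin 2 × jb) a b F ∧
      discardJunk (F (pureOp ψ)) = (p : ℂ) • pureOp bell}

/-! ### Assistance by the Bank

The registers `A`, `A'` belong to Alice, `B`, `B'` to Bob, and `K` to the Bank; all are qubits. -/

/-- The imperfect link `cos θ |00⟩ + sin θ |11⟩` on `A B`. -/
def link (θ : ℝ) : EuclideanSpace ℂ (Fin 2 × Fin 2) :=
  WithLp.toLp 2 fun i =>
    if i = (0, 0) then (Real.cos θ : ℂ) else if i = (1, 1) then (Real.sin θ : ℂ) else 0

/-- `α |000⟩ + β |111⟩` on `A' B' K`. -/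
def ghz (α β : ℝ) : EuclideanSpace ℂ (Fin 2 × Fin 2 × Fin 2) :=
  WithLp.toLp 2 fun i =>
    if i = (0, 0, 0) then (α : ℂ) else if i = (1, 1, 1) then (β : ℂ) else 0

/-- `α |001⟩ + β |010⟩ + γ |100⟩` on `A' B' K`. -/
def wState (α β γ : ℝ) : EuclideanSpace ℂ (Fin 2 × Fin 2 × Fin 2) :=
  WithLp.toLp 2 fun i =>
    if i = (0, 0, 1) then (α : ℂ) else if i = (0, 1, 0) then (β : ℂ)
    else if i = (1, 0, 0) then (γ : ℂ) else 0

/-- Transfer model: the state of link and resource across `A A' K | B B'`. -/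
def transferState (θ : ℝ) (Ω : EuclideanSpace ℂ (Fin 2 × Fin 2 × Fin 2)) :
    EuclideanSpace ℂ ((Fin 2 × Fin 2 × Fin 2) × (Fin 2 × Fin 2)) :=
  WithLp.toLp 2 fun i => link θ (i.1.1, i.2.1) * Ω (i.1.2.1, i.2.2, i.1.2.2)

/-- Bank-measures model: the unnormalised state across `A A' | B B'` after an outcome of the
measurement of `K` whose effect is `|e⟩⟨e|`, that is, `⟨e|_K` applied to link and resource.  Its
squared norm is the probability of the outcome. -/
def bankBranch (θ : ℝ) (Ω : EuclideanSpace ℂ (Fin 2 × Fin 2 × Fin 2))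
    (e : EuclideanSpace ℂ (Fin 2)) : EuclideanSpace ℂ ((Fin 2 × Fin 2) × (Fin 2 × Fin 2)) :=
  WithLp.toLp 2 fun i =>
    ∑ k, star (e k) * (link θ (i.1.1, i.2.1) * Ω (i.1.2, i.2.2, k))

/-- The normalised conditional state after the outcome. -/
def bankState (θ : ℝ) (Ω : EuclideanSpace ℂ (Fin 2 × Fin 2 × Fin 2))
    (e : EuclideanSpace ℂ (Fin 2)) : EuclideanSpace ℂ ((Fin 2 × Fin 2) × (Fin 2 × Fin 2)) :=
  (‖bankBranch θ Ω e‖⁻¹ : ℂ) • bankBranch θ Ω e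

/-- The effects `|e m⟩⟨e m|` form a measurement (a rank-one POVM) of the qubit `K`. -/
def IsMeasurement {ι : Type} [Fintype ι] (e : ι → EuclideanSpace ℂ (Fin 2)) : Prop :=
  ∑ m, pureOp (e m) = 1

/-- The measurement of `K` in the Hadamard basis: `|+⟩` for `m = 0` and `|-⟩` for `m = 1`. -/
def hadamard (m : Fin 2) : EuclideanSpace ℂ (Fin 2) :=
  WithLp.toLp 2 fun k => ((1 / √2 : ℝ) : ℂ) * (if m = 1 ∧ k = 1 then -1 else 1)

/-- The total probabilities of restoring a Bell pair when the Bank measures `K` by `e` and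
broadcasts the outcome `m`, after which Alice and Bob use an LOCC protocol that may depend
on `m`. -/
def bankProbs {ι : Type} [Fintype ι] (θ : ℝ) (Ω : EuclideanSpace ℂ (Fin 2 × Fin 2 × Fin 2))
    (e : ι → EuclideanSpace ℂ (Fin 2)) : Set ℝ :=
  {p | ∃ q : ι → ℝ, (∀ m, q m ∈ bellProbs (bankBranch θ Ω (e m))) ∧ p = ∑ m, q m}

end BellRestoration

end

noncomputable section

namespace BellRestoration

open scoped Matrix.Norms.L2Operator ComplexOrder
open Matrix

/-! ### The largest Schmidt coefficient as an operator norm -/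

/-! For a possibly unnormalised vector of squared norm `n` and largest squared Schmidt coefficient
`l`, the optimal probability is `min n (2 * (n - l))`, a quantity homogeneous of degree one in the
squared norm. The unnormalised form lets branches of a protocol or of the Bank's measurement simply
be added.

Upper bound: `l` is the squared operator norm of the coefficient matrix (`lambdaMax_eq_norm`), so by
the C*-identity and the triangle inequality a complete set of local Kraus operators does not
decrease the total `l`, while it preserves the total `n`. Hence the total of `n - l` never grows. A
branch accepted in a perfect Bell pair with junk has `2 * l ≤ n`, so its weight is at most `2 * (n -
l)`. That every accepted branch is perfect follows from the average being perfect: `bellDefect` is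
additive, nonnegative on pure branches, and zero on the final state (`LOCC.bellBounds`,
`bellProbs_le`).

Attainability: lowering the largest Schmidt coefficient to the sum of the others leaves total weight
`min n (2 * (n - l))`, with no entry above half of it (`exists_capped`). Such a list is the row-sum
vector of a symmetric nonnegative matrix `W` with zero diagonal (`exists_symmetric_weights`). Bob's
Kraus operator for a pair `i ≠ j` with positive weight filters the two Schmidt directions to equal
amplitudes, producing a maximally entangled pair with weight `W i j`; the row-sum condition makes
the filters subnormalised, and Alice rotates her two Schmidt vectors into place
(`sum_weights_mem_conversionProbs`).

With assistance, tensoring by the link multiplies `l` by `cos θ ^ 2` (`lambdaMax_linkTensor`), so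
only the eigenvalues of a qubit state of `B'` remain, read off from trace and determinant. For GHZ
resources and any measurement, one coefficient of each branch already bounds `l` from below, and
completeness of the measurement sums these bounds to the Hadamard value (`bankProbs_ghz_le`). -/

theorem l2_opNorm_isHermitian {n : Type} [Fintype n] [DecidableEq n] {A : Matrix n n ℂ}
    (hA : A.IsHermitian) : ‖A‖ = ‖hA.eigenvalues‖ := by
  conv_lhs => rw [hA.spectral_theorem, Unitary.conjStarAlgAut_apply]
  rw [← Unitary.coe_star, CStarRing.norm_mul_coe_unitary, CStarRing.norm_coe_unitary_mul,
    l2_opNorm_diagonal]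
  simp [Pi.norm_def]

theorem sq_l2_opNorm {m n : Type} [Fintype m] [Fintype n] [DecidableEq m] [DecidableEq n]
    (A : Matrix m n ℂ) : ‖A‖ ^ 2 = ‖A * Aᴴ‖ := by
  have := l2_opNorm_conjTranspose_mul_self Aᴴ
  rw [conjTranspose_conjTranspose, l2_opNorm_conjTranspose] at this
  rw [this, sq]

theorem schmidtSq_nonneg {a b : Type} [Fintype a] [Fintype b] [DecidableEq b]
    (ψ : EuclideanSpace ℂ (a × b)) (j : b) : 0 ≤ schmidtSq ψ j :=
  (posSemidef_self_mul_conjTranspose (coeffMatrix ψ)).eigenvalues_nonneg j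

theorem schmidtSq_le_lambdaMax {a b : Type} [Fintype a] [Fintype b] [DecidableEq b]
    (ψ : EuclideanSpace ℂ (a × b)) (j : b) : schmidtSq ψ j ≤ lambdaMax ψ :=
  le_ciSup (Set.finite_range _).bddAbove j

theorem lambdaMax_nonneg {a b : Type} [Fintype a] [Fintype b] [DecidableEq b]
    (ψ : EuclideanSpace ℂ (a × b)) : 0 ≤ lambdaMax ψ :=
  Real.iSup_nonneg (schmidtSq_nonneg ψ)

/-- In this form local operators act by matrix multiplication, and the symmetry between the parties
becomes invariance of the norm under transposition. -/
theorem lambdaMax_eq_norm {a b : Type} [Fintype a] [DecidableEq a] [Fintype b] [DecidableEq b]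
    (ψ : EuclideanSpace ℂ (a × b)) : lambdaMax ψ = ‖coeffMatrix ψ‖ ^ 2 := by
  rw [sq_l2_opNorm]
  change _ = ‖reducedBob ψ‖
  rw [l2_opNorm_isHermitian (reducedBob_isHermitian ψ)]
  apply le_antisymm
  · refine Real.iSup_le (fun j => ?_) (norm_nonneg _)
    exact (le_abs_self _).trans (norm_le_pi_norm (reducedBob_isHermitian ψ).eigenvalues j)
  · refine (pi_norm_le_iff_of_nonneg (lambdaMax_nonneg ψ)).2 fun j => ?_
    change ‖schmidtSq ψ j‖ ≤ _
    rw [Real.norm_of_nonneg (schmidtSq_nonneg ψ j)]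
    exact schmidtSq_le_lambdaMax ψ j

theorem norm_sq_eq_sum {n : Type} [Fintype n] (ψ : EuclideanSpace ℂ n) :
    ‖ψ‖ ^ 2 = ∑ i, ‖ψ i‖ ^ 2 := EuclideanSpace.norm_sq_eq ψ

theorem sq_l2_opNorm_le {m n : Type} [Fintype m] [Fintype n] [DecidableEq m] [DecidableEq n]
    (A : Matrix m n ℂ) {C : ℝ} (hC : 0 ≤ C)
    (h : ∀ u : n → ℂ, ∑ j, ‖(A *ᵥ u) j‖ ^ 2 ≤ C * ∑ i, ‖u i‖ ^ 2) : ‖A‖ ^ 2 ≤ C := by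
  have : ‖A‖ ≤ √C := by
    rw [l2_opNorm_def]
    refine ContinuousLinearMap.opNorm_le_bound _ (Real.sqrt_nonneg _) fun u => ?_
    refine (sq_le_sq₀ (norm_nonneg _) (by positivity)).1 ?_
    rw [mul_pow, Real.sq_sqrt hC, norm_sq_eq_sum, norm_sq_eq_sum]
    exact h u
  calc ‖A‖ ^ 2 ≤ √C ^ 2 := by gcongr
    _ = C := Real.sq_sqrt hC

theorem sum_sq_mulVec_le {m n : Type} [Fintype m] [Fintype n] [DecidableEq m] [DecidableEq n]
    (A : Matrix m n ℂ) (u : n → ℂ) :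
    ∑ j, ‖(A *ᵥ u) j‖ ^ 2 ≤ ‖A‖ ^ 2 * ∑ i, ‖u i‖ ^ 2 := by
  have := l2_opNorm_mulVec A (WithLp.toLp 2 u)
  have h2 := pow_le_pow_left₀ (norm_nonneg _) this 2
  rw [mul_pow, norm_sq_eq_sum, norm_sq_eq_sum] at h2
  exact h2

/-- A complete family of Kraus operators does not decrease the sum of squared operator norms. -/
theorem sq_norm_le_sum {n m : Type} [Fintype n] [Fintype m] [DecidableEq n] [DecidableEq m]
    {ι : Type} [Fintype ι] {κ : ι → Type} [∀ i, Fintype (κ i)]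
    {a' : ι → Type} [∀ i, Fintype (a' i)] [∀ i, DecidableEq (a' i)]
    (K : ∀ i, κ i → Matrix (a' i) n ℂ) (hK : ∑ i, ∑ k, (K i k)ᴴ * K i k = 1)
    (A : Matrix n m ℂ) : ‖A‖ ^ 2 ≤ ∑ i, ∑ k, ‖K i k * A‖ ^ 2 := by
  -- Completeness is inserted between the two factors; the triangle inequality and the C*-identity
  -- then give the claim.
  have h : Aᴴ * A = ∑ i, ∑ k, (K i k * A)ᴴ * (K i k * A) := by
    calc Aᴴ * A = Aᴴ * (∑ i, ∑ k, (K i k)ᴴ * K i k) * A := by rw [hK, Matrix.mul_one]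
      _ = _ := by
        simp only [Matrix.mul_sum, Matrix.sum_mul, conjTranspose_mul, Matrix.mul_assoc]
  rw [sq, ← l2_opNorm_conjTranspose_mul_self, h]
  refine (norm_sum_le _ _).trans (Finset.sum_le_sum fun i _ => ?_)
  refine (norm_sum_le _ _).trans (Finset.sum_le_sum fun k _ => ?_)
  rw [l2_opNorm_conjTranspose_mul_self, sq]

/-! ### Local operators acting on vectors -/

/-- `(K ⊗ 1) ψ`. -/
def actAlice {a a' b : Type} [Fintype a] (K : Matrix a' a ℂ) (ψ : EuclideanSpace ℂ (a × b)) :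
    EuclideanSpace ℂ (a' × b) :=
  WithLp.toLp 2 fun i => ∑ x, K i.1 x * ψ (x, i.2)

/-- `(1 ⊗ K) ψ`. -/
def actBob {a b b' : Type} [Fintype b] (K : Matrix b' b ℂ) (ψ : EuclideanSpace ℂ (a × b)) :
    EuclideanSpace ℂ (a × b') :=
  WithLp.toLp 2 fun i => ∑ y, K i.2 y * ψ (i.1, y)

theorem pureOp_eq_vecMulVec {n : Type} (ψ : EuclideanSpace ℂ n) :
    pureOp ψ = vecMulVec ψ (star ψ.ofLp) := rfl

theorem onAlice_pureOp {a a' b : Type} [Fintype a] [Fintype b] [DecidableEq b]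
    (K : Matrix a' a ℂ) (ψ : EuclideanSpace ℂ (a × b)) :
    onAlice K (pureOp ψ) = pureOp (actAlice K ψ) := by
  have h : (K ⊗ₖ (1 : Matrix b b ℂ)) *ᵥ ψ.ofLp = (actAlice K ψ).ofLp := by
    ext i
    simp [mulVec, dotProduct, Fintype.sum_prod_type, kroneckerMap_apply, actAlice, one_apply]
  rw [onAlice, pureOp_eq_vecMulVec, pureOp_eq_vecMulVec, mul_vecMulVec, vecMulVec_mul, h,
    ← star_mulVec, h]

theorem onBob_pureOp {a b b' : Type} [Fintype a] [DecidableEq a] [Fintype b]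
    (K : Matrix b' b ℂ) (ψ : EuclideanSpace ℂ (a × b)) :
    onBob K (pureOp ψ) = pureOp (actBob K ψ) := by
  have h : ((1 : Matrix a a ℂ) ⊗ₖ K) *ᵥ ψ.ofLp = (actBob K ψ).ofLp := by
    ext i
    simp [mulVec, dotProduct, Fintype.sum_prod_type, kroneckerMap_apply, actBob, one_apply]
  rw [onBob, pureOp_eq_vecMulVec, pureOp_eq_vecMulVec, mul_vecMulVec, vecMulVec_mul, h,
    ← star_mulVec, h]

theorem coeffMatrix_actAlice {a a' b : Type} [Fintype a] (K : Matrix a' a ℂ)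
    (ψ : EuclideanSpace ℂ (a × b)) : coeffMatrix (actAlice K ψ) = coeffMatrix ψ * Kᵀ := by
  ext j i
  simp [coeffMatrix, actAlice, mul_apply, mul_comm]

theorem coeffMatrix_actBob {a b b' : Type} [Fintype b] (K : Matrix b' b ℂ)
    (ψ : EuclideanSpace ℂ (a × b)) : coeffMatrix (actBob K ψ) = K * coeffMatrix ψ := by
  ext j i
  simp [coeffMatrix, actBob, mul_apply]

theorem trace_pureOp {n : Type} [Fintype n] (ψ : EuclideanSpace ℂ n) :
    (pureOp ψ).trace = ((‖ψ‖ ^ 2 : ℝ) : ℂ) := by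
  rw [norm_sq_eq_sum]
  simp [trace, pureOp, Complex.mul_conj, Complex.normSq_eq_norm_sq]

theorem trace_pureOp_eq_coeff {a b : Type} [Fintype a] [Fintype b]
    (ψ : EuclideanSpace ℂ (a × b)) :
    (pureOp ψ).trace = ((coeffMatrix ψ)ᴴ * coeffMatrix ψ).trace := by
  simp [trace, pureOp, coeffMatrix, mul_apply, Fintype.sum_prod_type, mul_comm]

theorem sum_norm_sq_actBob {a b : Type} [Fintype a] [DecidableEq a] [Fintype b] [DecidableEq b]
    {ι : Type} [Fintype ι] {κ : ι → Type} [∀ i, Fintype (κ i)]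
    {b' : ι → Type} [∀ i, Fintype (b' i)]
    (K : ∀ i, κ i → Matrix (b' i) b ℂ) (hK : ∑ i, ∑ k, (K i k)ᴴ * K i k = 1)
    (ψ : EuclideanSpace ℂ (a × b)) : ∑ i, ∑ k, ‖actBob (K i k) ψ‖ ^ 2 = ‖ψ‖ ^ 2 := by
  have h : (coeffMatrix ψ)ᴴ * coeffMatrix ψ =
      ∑ i, ∑ k, (K i k * coeffMatrix ψ)ᴴ * (K i k * coeffMatrix ψ) := by
    calc _ = (coeffMatrix ψ)ᴴ * (∑ i, ∑ k, (K i k)ᴴ * K i k) * coeffMatrix ψ := by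
            rw [hK, Matrix.mul_one]
      _ = _ := by
        simp only [Matrix.mul_sum, Matrix.sum_mul, conjTranspose_mul, Matrix.mul_assoc]
  apply Complex.ofReal_injective
  rw [← trace_pureOp, trace_pureOp_eq_coeff, h]
  simp only [trace_sum, Complex.ofReal_sum, ← trace_pureOp, trace_pureOp_eq_coeff,
    coeffMatrix_actBob]

/-- Exchanging the roles of Alice and Bob. -/
def swapParties {a b : Type} (ψ : EuclideanSpace ℂ (a × b)) : EuclideanSpace ℂ (b × a) :=
  WithLp.toLp 2 fun i => ψ i.swap

theorem norm_sq_swapParties {a b : Type} [Fintype a] [Fintype b]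
    (ψ : EuclideanSpace ℂ (a × b)) : ‖swapParties ψ‖ ^ 2 = ‖ψ‖ ^ 2 := by
  rw [norm_sq_eq_sum, norm_sq_eq_sum]
  exact Equiv.sum_comp (Equiv.prodComm b a) fun i => ‖ψ i‖ ^ 2

theorem swapParties_actAlice {a a' b : Type} [Fintype a] (K : Matrix a' a ℂ)
    (ψ : EuclideanSpace ℂ (a × b)) :
    swapParties (actAlice K ψ) = actBob K (swapParties ψ) := rfl

/-- The transpose is the adjoint of the entrywise conjugate, and conjugating the entries only
conjugates input and output vectors. This transfers the estimates for Bob's operators to Alice's. -/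
theorem norm_transpose {m n : Type} [Fintype m] [Fintype n] [DecidableEq m] [DecidableEq n]
    (A : Matrix m n ℂ) : ‖Aᵀ‖ = ‖A‖ := by
  have key : ∀ {p q : Type} [Fintype p] [Fintype q] [DecidableEq p] [DecidableEq q]
      (B : Matrix p q ℂ), ‖B.map star‖ ^ 2 ≤ ‖B‖ ^ 2 := by
    intro p q _ _ _ _ B
    refine sq_l2_opNorm_le _ (by positivity) fun u => ?_
    have := sum_sq_mulVec_le B (star u)
    have h : ∀ j, ‖(B.map star *ᵥ u) j‖ = ‖(B *ᵥ star u) j‖ := by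
      intro j
      rw [← norm_star ((B *ᵥ star u) j)]
      congr 1
      simp [mulVec, dotProduct, star_sum, mul_comm]
    simp only [← h, Pi.star_apply, norm_star] at this
    exact this
  have h1 : ‖Aᵀ‖ = ‖A.map star‖ := by
    rw [← l2_opNorm_conjTranspose]
    congr 1
  rw [h1]
  apply le_antisymm <;> refine (sq_le_sq₀ (norm_nonneg _) (norm_nonneg _)).1 ?_
  · exact key A
  · have := key (A.map star)
    rwa [Matrix.map_map, show (star ∘ star : ℂ → ℂ) = id from funext star_star,
      Matrix.map_id] at this

theorem norm_coeffMatrix_swapParties {a b : Type} [Fintype a] [Fintype b] [DecidableEq a]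
    [DecidableEq b] (ψ : EuclideanSpace ℂ (a × b)) :
    ‖coeffMatrix (swapParties ψ)‖ = ‖coeffMatrix ψ‖ :=
  norm_transpose (coeffMatrix ψ)

theorem norm_sq_actAlice {a a' b : Type} [Fintype a] [Fintype a'] [Fintype b]
    (K : Matrix a' a ℂ) (ψ : EuclideanSpace ℂ (a × b)) :
    ‖actAlice K ψ‖ ^ 2 = ‖actBob K (swapParties ψ)‖ ^ 2 := by
  rw [← swapParties_actAlice, norm_sq_swapParties]

theorem norm_coeffMatrix_actAlice {a a' b : Type} [Fintype a] [Fintype a'] [Fintype b]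
    [DecidableEq a'] [DecidableEq b] (K : Matrix a' a ℂ) (ψ : EuclideanSpace ℂ (a × b)) :
    ‖coeffMatrix (actAlice K ψ)‖ = ‖coeffMatrix (actBob K (swapParties ψ))‖ := by
  rw [← swapParties_actAlice, norm_coeffMatrix_swapParties]

/-! ### Upper bound on the success probability -/

/-- The sum of the expectations of (the reduced state of) `σ`
in the unnormalised vectors `|01⟩`, `|10⟩` and `|00⟩ - |11⟩`, which are orthogonal to the Bell
state. -/
def bellDefect {ja jb : Type} [Fintype ja] [Fintype jb]
    (σ : Matrix ((Fin 2 × ja) × (Fin 2 × jb)) ((Fin 2 × ja) × (Fin 2 × jb)) ℂ) : ℝ :=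
  (discardJunk σ (0, 1) (0, 1) + discardJunk σ (1, 0) (1, 0) + discardJunk σ (0, 0) (0, 0) +
    discardJunk σ (1, 1) (1, 1) - discardJunk σ (0, 0) (1, 1) - discardJunk σ (1, 1) (0, 0)).re

theorem discardJunk_sum {ja jb : Type} [Fintype ja] [Fintype jb] {s : Type} [Fintype s]
    (σ : s → Matrix ((Fin 2 × ja) × (Fin 2 × jb)) ((Fin 2 × ja) × (Fin 2 × jb)) ℂ) :
    discardJunk (∑ i, σ i) = ∑ i, discardJunk (σ i) := by
  ext p q
  simp only [discardJunk, of_apply, Matrix.sum_apply]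
  exact (Finset.sum_congr rfl fun x _ => Finset.sum_comm).trans Finset.sum_comm

theorem bellDefect_sum {ja jb : Type} [Fintype ja] [Fintype jb] {s : Type} [Fintype s]
    (σ : s → Matrix ((Fin 2 × ja) × (Fin 2 × jb)) ((Fin 2 × ja) × (Fin 2 × jb)) ℂ) :
    bellDefect (∑ i, σ i) = ∑ i, bellDefect (σ i) := by
  simp only [bellDefect, discardJunk_sum, Matrix.sum_apply, Complex.add_re, Complex.sub_re,
    Complex.re_sum, Finset.sum_add_distrib, Finset.sum_sub_distrib]

theorem bellDefect_pureOp {ja jb : Type} [Fintype ja] [Fintype jb]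
    (φ : EuclideanSpace ℂ ((Fin 2 × ja) × (Fin 2 × jb))) :
    bellDefect (pureOp φ) = ∑ x, ∑ y, (‖φ ((0, x), (1, y))‖ ^ 2 + ‖φ ((1, x), (0, y))‖ ^ 2 +
      ‖φ ((0, x), (0, y)) - φ ((1, x), (1, y))‖ ^ 2) := by
  simp only [bellDefect, discardJunk, pureOp, of_apply, ← Finset.sum_add_distrib,
    ← Finset.sum_sub_distrib, Complex.re_sum]
  refine Finset.sum_congr rfl fun x _ => Finset.sum_congr rfl fun y _ => ?_
  simp only [← Complex.normSq_eq_norm_sq, Complex.normSq_apply, Complex.add_re, Complex.sub_re,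
    Complex.mul_re, Complex.sub_im, Complex.star_def, Complex.conj_re, Complex.conj_im]
  ring

theorem bellDefect_pureOp_nonneg {ja jb : Type} [Fintype ja] [Fintype jb]
    (φ : EuclideanSpace ℂ ((Fin 2 × ja) × (Fin 2 × jb))) : 0 ≤ bellDefect (pureOp φ) := by
  rw [bellDefect_pureOp]
  positivity

theorem sum_sq_dotProduct_le {n : Type} [Fintype n] (f u : n → ℂ) :
    ‖∑ i, f i * u i‖ ^ 2 ≤ (∑ i, ‖f i‖ ^ 2) * ∑ i, ‖u i‖ ^ 2 := by
  refine le_trans ?_ (Finset.sum_mul_sq_le_sq_mul_sq Finset.univ (fun i => ‖f i‖) fun i => ‖u i‖)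
  gcongr
  refine (norm_sum_le _ _).trans (le_of_eq ?_)
  simp

/-- A vector without Bell defect has largest squared Schmidt coefficient at most half of its
squared norm. -/
theorem two_mul_sq_norm_coeffMatrix_le {ja jb : Type} [Fintype ja] [Fintype jb] [DecidableEq ja]
    [DecidableEq jb] (φ : EuclideanSpace ℂ ((Fin 2 × ja) × (Fin 2 × jb)))
    (h : bellDefect (pureOp φ) = 0) : 2 * ‖coeffMatrix φ‖ ^ 2 ≤ ‖φ‖ ^ 2 := by
  rw [bellDefect_pureOp, Finset.sum_eq_zero_iff_of_nonneg (fun _ _ => by positivity)] at h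
  have h' : ∀ x y, φ ((0, x), (1, y)) = 0 ∧ φ ((1, x), (0, y)) = 0 ∧
      φ ((0, x), (0, y)) = φ ((1, x), (1, y)) := by
    intro x y
    have := h x (Finset.mem_univ _)
    rw [Finset.sum_eq_zero_iff_of_nonneg (fun _ _ => by positivity)] at this
    have := this y (Finset.mem_univ _)
    have h1 := sq_nonneg ‖φ ((0, x), (1, y))‖
    have h2 := sq_nonneg ‖φ ((1, x), (0, y))‖
    have h3 := sq_nonneg ‖φ ((0, x), (0, y)) - φ ((1, x), (1, y))‖
    refine ⟨?_, ?_, ?_⟩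
    · simpa using (by linarith : ‖φ ((0, x), (1, y))‖ ^ 2 = 0)
    · simpa using (by linarith : ‖φ ((1, x), (0, y))‖ ^ 2 = 0)
    · simpa [sub_eq_zero] using
        (by linarith : ‖φ ((0, x), (0, y)) - φ ((1, x), (1, y))‖ ^ 2 = 0)
  -- The coefficient matrix is now block diagonal with two equal blocks. `S` is the squared
  -- Frobenius norm of one block: it bounds the squared operator norm and is half of the squared
  -- norm of `φ`.
  set S := ∑ y, ∑ x, ‖φ ((1, x), (1, y))‖ ^ 2 with hS
  have hφ : ‖φ‖ ^ 2 = 2 * S := by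
    rw [norm_sq_eq_sum, Fintype.sum_prod_type, Fintype.sum_prod_type]
    simp only [Fin.sum_univ_two, Fintype.sum_prod_type, (h' _ _).1, (h' _ _).2.1, (h' _ _).2.2]
    rw [hS, Finset.sum_comm]
    simp
    ring
  have hS0 : 0 ≤ S := by positivity
  rw [hφ]
  gcongr
  refine sq_l2_opNorm_le _ hS0 fun u => ?_
  rw [Fintype.sum_prod_type, Fintype.sum_prod_type, Finset.mul_sum]
  simp only [mulVec, dotProduct, coeffMatrix, of_apply, Fintype.sum_prod_type, Fin.sum_univ_two,
    (h' _ _).1, (h' _ _).2.1, (h' _ _).2.2]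
  simp only [zero_mul, Finset.sum_const_zero, add_zero, zero_add]
  have key : ∀ w : ja → ℂ, ∑ y, ‖∑ x, φ ((1, x), (1, y)) * w x‖ ^ 2 ≤ S * ∑ x, ‖w x‖ ^ 2 := by
    intro w
    rw [hS, Finset.sum_mul]
    exact Finset.sum_le_sum fun y _ => sum_sq_dotProduct_le (fun x => φ ((1, x), (1, y))) w
  exact add_le_add (key _) (key _)

/-- Bounds satisfied by the final state `σ` of a protocol which starts in a vector of squared norm
`n` and largest squared Schmidt coefficient `l`. -/
def BellBounds {ja jb : Type} [Fintype ja] [Fintype jb] (n l : ℝ)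
    (σ : Matrix ((Fin 2 × ja) × (Fin 2 × jb)) ((Fin 2 × ja) × (Fin 2 × jb)) ℂ) : Prop :=
  0 ≤ bellDefect σ ∧ σ.trace.re ≤ n ∧ (bellDefect σ = 0 → σ.trace.re ≤ 2 * (n - l))

/-- A vanishing sum of nonnegative defects forces each defect to vanish, so the conditional bound is
available in every branch; the hypothesis on `l` points in the direction needed to add them. -/
theorem BellBounds.sum {ja jb s : Type} [Fintype ja] [Fintype jb] [Fintype s] {n l : ℝ}
    {n' l' : s → ℝ}
    {σ : s → Matrix ((Fin 2 × ja) × (Fin 2 × jb)) ((Fin 2 × ja) × (Fin 2 × jb)) ℂ}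
    (h : ∀ i, BellBounds (n' i) (l' i) (σ i)) (hn : ∑ i, n' i = n) (hl : l ≤ ∑ i, l' i) :
    BellBounds n l (∑ i, σ i) := by
  rw [BellBounds, bellDefect_sum, trace_sum, Complex.re_sum]
  refine ⟨Finset.sum_nonneg fun i _ => (h i).1, ?_, fun h0 => ?_⟩
  · rw [← hn]
    exact Finset.sum_le_sum fun i _ => (h i).2.1
  · rw [Finset.sum_eq_zero_iff_of_nonneg fun i _ => (h i).1] at h0
    calc ∑ i, (σ i).trace.re ≤ ∑ i, 2 * (n' i - l' i) :=
          Finset.sum_le_sum fun i hi => (h i).2.2 (h0 i hi)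
      _ = 2 * (n - ∑ i, l' i) := by rw [← Finset.mul_sum, Finset.sum_sub_distrib, hn]
      _ ≤ _ := by linarith

theorem sq_norm_coeffMatrix_le {a b : Type} [Fintype a] [DecidableEq a] [Fintype b]
    [DecidableEq b] (ψ : EuclideanSpace ℂ (a × b)) : ‖coeffMatrix ψ‖ ^ 2 ≤ ‖ψ‖ ^ 2 := by
  refine sq_l2_opNorm_le _ (by positivity) fun u => ?_
  rw [norm_sq_eq_sum, Fintype.sum_prod_type, Finset.sum_comm, Finset.sum_mul]
  exact Finset.sum_le_sum fun j _ => sum_sq_dotProduct_le (fun i => ψ (i, j)) u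

/-- Additivity of `F` is part of the induction because forgetting the Kraus index `k` creates mixed
states: by additivity the remaining protocol may be applied to each pure term separately. -/
theorem LOCC.bellBounds {ja jb : Type} [Fintype ja] [DecidableEq ja] [Fintype jb] [DecidableEq jb]
    {a b : Type} [Fintype a] [DecidableEq a] [Fintype b] [DecidableEq b]
    {F : Matrix (a × b) (a × b) ℂ →
      Matrix ((Fin 2 × ja) × (Fin 2 × jb)) ((Fin 2 × ja) × (Fin 2 × jb)) ℂ}
    (h : LOCC (Fin 2 × ja) (Fin 2 × jb) a b F) :
    (∃ G : Matrix (a × b) (a × b) ℂ →+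
      Matrix ((Fin 2 × ja) × (Fin 2 × jb)) ((Fin 2 × ja) × (Fin 2 × jb)) ℂ, ⇑G = F) ∧
    ∀ ψ, BellBounds (‖ψ‖ ^ 2) (‖coeffMatrix ψ‖ ^ 2) (F (pureOp ψ)) := by
  induction h with
  | accept =>
    refine ⟨⟨AddMonoidHom.id _, rfl⟩, fun ψ => ⟨bellDefect_pureOp_nonneg ψ, ?_, fun h0 => ?_⟩⟩
    · rw [trace_pureOp, Complex.ofReal_re]
    · rw [trace_pureOp, Complex.ofReal_re]
      linarith [two_mul_sq_norm_coeffMatrix_le ψ h0]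
  | abort =>
    refine ⟨⟨0, rfl⟩, fun ψ => ⟨by simp [bellDefect, discardJunk], by simp, fun _ => ?_⟩⟩
    simpa using sq_norm_coeffMatrix_le ψ
  | @alice a b _ _ _ _ ι _ κ _ a' _ _ K hK F _ ih =>
    choose hG hB using ih
    choose G hG using hG
    refine ⟨⟨∑ i, (G i).comp (∑ k, AddMonoidHom.mk' (onAlice (K i k)) fun x y => by
      simp [onAlice, Matrix.mul_add, Matrix.add_mul]), ?_⟩, fun ψ => ?_⟩
    · ext ρ : 1
      rw [AddMonoidHom.finsetSum_apply]
      refine Finset.sum_congr rfl fun i _ => ?_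
      rw [AddMonoidHom.comp_apply, AddMonoidHom.finsetSum_apply, hG]
      rfl
    · have hsum : ∑ i, F i (∑ k, onAlice (K i k) (pureOp ψ)) =
          ∑ s : (i : ι) × κ i, F s.1 (pureOp (actAlice (K s.1 s.2) ψ)) := by
        rw [Fintype.sum_sigma]
        refine Finset.sum_congr rfl fun i _ => ?_
        simp only [onAlice_pureOp, ← hG, map_sum]
      beta_reduce
      rw [hsum]
      have hs : ∀ s : (i : ι) × κ i, BellBounds (‖actAlice (K s.1 s.2) ψ‖ ^ 2)
          (‖coeffMatrix (actAlice (K s.1 s.2) ψ)‖ ^ 2)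
          (F s.1 (pureOp (actAlice (K s.1 s.2) ψ))) := fun s => hB s.1 (actAlice (K s.1 s.2) ψ)
      have hn : ∑ s : (i : ι) × κ i, ‖actAlice (K s.1 s.2) ψ‖ ^ 2 = ‖ψ‖ ^ 2 := by
        simp only [norm_sq_actAlice]
        rw [← norm_sq_swapParties ψ]
        rw [Fintype.sum_sigma]
        exact sum_norm_sq_actBob K hK _
      have hl : ‖coeffMatrix ψ‖ ^ 2 ≤
          ∑ s : (i : ι) × κ i, ‖coeffMatrix (actAlice (K s.1 s.2) ψ)‖ ^ 2 := by
        simp only [norm_coeffMatrix_actAlice, coeffMatrix_actBob]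
        rw [← norm_coeffMatrix_swapParties ψ]
        rw [Fintype.sum_sigma]
        exact sq_norm_le_sum K hK _
      exact BellBounds.sum hs hn hl
  | @bob a b _ _ _ _ ι _ κ _ b' _ _ K hK F _ ih =>
    choose hG hB using ih
    choose G hG using hG
    refine ⟨⟨∑ i, (G i).comp (∑ k, AddMonoidHom.mk' (onBob (K i k)) fun x y => by
      simp [onBob, Matrix.mul_add, Matrix.add_mul]), ?_⟩, fun ψ => ?_⟩
    · ext ρ : 1
      rw [AddMonoidHom.finsetSum_apply]
      refine Finset.sum_congr rfl fun i _ => ?_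
      rw [AddMonoidHom.comp_apply, AddMonoidHom.finsetSum_apply, hG]
      rfl
    · have hsum : ∑ i, F i (∑ k, onBob (K i k) (pureOp ψ)) =
          ∑ s : (i : ι) × κ i, F s.1 (pureOp (actBob (K s.1 s.2) ψ)) := by
        rw [Fintype.sum_sigma]
        refine Finset.sum_congr rfl fun i _ => ?_
        simp only [onBob_pureOp, ← hG, map_sum]
      beta_reduce
      rw [hsum]
      have hs : ∀ s : (i : ι) × κ i, BellBounds (‖actBob (K s.1 s.2) ψ‖ ^ 2)
          (‖coeffMatrix (actBob (K s.1 s.2) ψ)‖ ^ 2)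
          (F s.1 (pureOp (actBob (K s.1 s.2) ψ))) := fun s => hB s.1 (actBob (K s.1 s.2) ψ)
      have hn : ∑ s : (i : ι) × κ i, ‖actBob (K s.1 s.2) ψ‖ ^ 2 = ‖ψ‖ ^ 2 := by
        rw [Fintype.sum_sigma]
        exact sum_norm_sq_actBob K hK _
      have hl : ‖coeffMatrix ψ‖ ^ 2 ≤
          ∑ s : (i : ι) × κ i, ‖coeffMatrix (actBob (K s.1 s.2) ψ)‖ ^ 2 := by
        simp only [coeffMatrix_actBob]
        rw [Fintype.sum_sigma]
        exact sq_norm_le_sum K hK _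
      exact BellBounds.sum hs hn hl

theorem trace_discardJunk {ja jb : Type} [Fintype ja] [Fintype jb]
    (σ : Matrix ((Fin 2 × ja) × (Fin 2 × jb)) ((Fin 2 × ja) × (Fin 2 × jb)) ℂ) :
    (discardJunk σ).trace = σ.trace := by
  simp only [trace, diag, discardJunk, of_apply, Fintype.sum_prod_type, Fin.sum_univ_two,
    Finset.sum_add_distrib]

theorem norm_bell : ‖bell‖ ^ 2 = 1 := by
  rw [norm_sq_eq_sum, Fintype.sum_prod_type]
  simp [bell, Fin.sum_univ_two]
  norm_num

theorem bellProbs_le {a b : Type} [Fintype a] [DecidableEq a] [Fintype b] [DecidableEq b]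
    {ψ : EuclideanSpace ℂ (a × b)} {p : ℝ} (hp : p ∈ bellProbs ψ) :
    p ≤ min (‖ψ‖ ^ 2) (2 * (‖ψ‖ ^ 2 - lambdaMax ψ)) := by
  obtain ⟨ja, jb, _, _, _, _, F, hF, h⟩ := hp
  obtain ⟨-, h1, h2⟩ := hF.bellBounds.2 ψ
  have ht : (F (pureOp ψ)).trace.re = p := by
    rw [← trace_discardJunk, h, trace_smul, trace_pureOp, norm_bell]
    simp
  have hd : bellDefect (F (pureOp ψ)) = 0 := by
    rw [bellDefect, h]
    simp [pureOp, bell]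
  rw [ht] at h1 h2
  rw [lambdaMax_eq_norm]
  exact le_min h1 (h2 hd)

theorem discardJunk_pureOp_bellWithJunk {ja jb : Type} [Fintype ja] [Fintype jb]
    {x : EuclideanSpace ℂ ja} {y : EuclideanSpace ℂ jb} (hx : ‖x‖ = 1) (hy : ‖y‖ = 1) :
    discardJunk (pureOp (bellWithJunk x y)) = pureOp bell := by
  have hx' : ∑ i, x i * star (x i) = 1 := by
    have := trace_pureOp x
    rw [hx] at this
    simpa [trace, pureOp] using this
  have hy' : ∑ i, y i * star (y i) = 1 := by
    have := trace_pureOp y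
    rw [hy] at this
    simpa [trace, pureOp] using this
  ext i j
  simp only [discardJunk, pureOp, bellWithJunk, of_apply]
  calc _ = ∑ k, ∑ l, bell i * star (bell j) * ((x k * star (x k)) * (y l * star (y l))) := by
        refine Finset.sum_congr rfl fun k _ => Finset.sum_congr rfl fun l _ => ?_
        simp only [star_mul']
        ring
    _ = _ := by simp only [← Finset.mul_sum, hx', hy', mul_one]

theorem conversionProbs_bellWithJunk_subset {a b ja jb : Type} [Fintype a] [DecidableEq a]
    [Fintype b] [DecidableEq b] [Fintype ja] [DecidableEq ja] [Fintype jb] [DecidableEq jb]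
    (ψ : EuclideanSpace ℂ (a × b)) {x : EuclideanSpace ℂ ja} {y : EuclideanSpace ℂ jb}
    (hx : ‖x‖ = 1) (hy : ‖y‖ = 1) : conversionProbs ψ (bellWithJunk x y) ⊆ bellProbs ψ := by
  rintro p ⟨F, hF, h⟩
  refine ⟨ja, jb, _, _, _, _, F, hF, ?_⟩
  rw [h, ← discardJunk_pureOp_bellWithJunk hx hy]
  ext i j
  simp [discardJunk, Finset.mul_sum]

/-! ### Symmetric weights with prescribed row sums -/

/-- Take a maximal set `P` of weight at most half. Adding any further `k` exceeds half, so `P`,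
`{k}` and the rest are three light groups. -/
theorem exists_three_groups {b : Type} [Fintype b] [DecidableEq b] (l : b → ℝ)
    (h0 : ∀ i, 0 ≤ l i) (h : ∀ i, 2 * l i ≤ ∑ j, l j) :
    ∃ g : b → Fin 3, ∀ k, 2 * ∑ i with g i = k, l i ≤ ∑ j, l j := by
  have hS : 0 ≤ ∑ j, l j := Finset.sum_nonneg fun i _ => h0 i
  obtain ⟨P, hP⟩ := (Set.toFinite {P : Finset b | 2 * ∑ i ∈ P, l i ≤ ∑ j, l j}).exists_maximal
    ⟨∅, by simpa using hS⟩
  by_cases hu : ∃ k, k ∉ P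
  · obtain ⟨k, hk⟩ := hu
    have hk' : ∑ j, l j < 2 * ∑ i ∈ insert k P, l i := by
      by_contra! hc
      exact hk (hP.le_of_ge hc (Finset.subset_insert k P) (Finset.mem_insert_self k P))
    refine ⟨fun i => if i ∈ P then 0 else if i = k then 1 else 2, ?_⟩
    have e0 : (Finset.univ.filter fun i => (if i ∈ P then (0 : Fin 3) else if i = k then 1 else 2)
        = 0) = P := by
      ext i; by_cases hi : i ∈ P <;> by_cases hik : i = k <;> simp [hi, hik]
    have e1 : (Finset.univ.filter fun i => (if i ∈ P then (0 : Fin 3) else if i = k then 1 else 2)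
        = 1) = {k} := by
      ext i; by_cases hi : i ∈ P <;> by_cases hik : i = k <;> simp_all
    have e2 : (Finset.univ.filter fun i => (if i ∈ P then (0 : Fin 3) else if i = k then 1 else 2)
        = 2) = (insert k P)ᶜ := by
      ext i; by_cases hi : i ∈ P <;> by_cases hik : i = k <;> simp_all
    intro j
    fin_cases j
    · simp only [Fin.zero_eta, e0]
      exact hP.prop
    · simp only [Fin.mk_one, e1, Finset.sum_singleton]
      exact h k
    · have := Finset.sum_add_sum_compl (insert k P) l
      simp only [Fin.reduceFinMk, e2]
      linarith
  -- If `P` is everything, the total is at most half of itself, and a single group suffices.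
  · push Not at hu
    have hPu : P = Finset.univ := Finset.eq_univ_of_forall hu
    have := hP.prop
    simp only [hPu, Set.mem_ofPred_eq] at this
    refine ⟨fun _ => 0, fun k => ?_⟩
    have := Finset.sum_le_sum_of_subset_of_nonneg
      (Finset.filter_subset (fun _ : b => (0 : Fin 3) = k) Finset.univ) fun i _ _ => h0 i
    linarith

/-- For three numbers satisfying the triangle inequalities the off-diagonal weights are explicit.
The general case groups the entries into three and spreads each weight between two groups
proportionally to `l i * l j`. -/
theorem exists_symmetric_weights {b : Type} [Fintype b] [DecidableEq b] (l : b → ℝ)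
    (h0 : ∀ i, 0 ≤ l i) (h : ∀ i, 2 * l i ≤ ∑ j, l j) :
    ∃ W : b → b → ℝ, (∀ i j, 0 ≤ W i j) ∧ (∀ i, W i i = 0) ∧ (∀ i j, W i j = W j i) ∧
      ∀ i, ∑ j, W i j = l i := by
  obtain ⟨g, hg⟩ := exists_three_groups l h0 h
  set s : Fin 3 → ℝ := fun k => ∑ i with g i = k, l i with hs
  set S := ∑ j, l j with hS
  have hs0 : ∀ k, 0 ≤ s k := fun k => Finset.sum_nonneg fun i _ => h0 i
  have hsS : s 0 + s 1 + s 2 = S := by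
    rw [hS, ← Finset.sum_fiberwise Finset.univ g l, Fin.sum_univ_three]
  have hpair : ∀ k k', k ≠ k' → S ≤ 2 * (s k + s k') := by
    have h0 := hg 0
    have h1 := hg 1
    have h2 := hg 2
    change 2 * s 0 ≤ S at h0
    change 2 * s 1 ≤ S at h1
    change 2 * s 2 ≤ S at h2
    intro k k' hk
    fin_cases k <;> fin_cases k' <;> simp at hk ⊢ <;> linarith
  -- The total weight between groups `k` and `k'` must be half of `s k + s k'` minus the third sum,
  -- that is `(2 * (s k + s k') - S) / 2`; `C` divides it by `s k * s k'`.
  set C : Fin 3 → Fin 3 → ℝ := fun k k' =>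
    if k = k' then 0 else (2 * (s k + s k') - S) / (2 * s k * s k') with hC
  have hC0 : ∀ k k', 0 ≤ C k k' := by
    intro k k'
    simp only [hC]
    split_ifs with hk
    · exact le_rfl
    · have := hpair k k' hk
      have := hs0 k
      have := hs0 k'
      exact div_nonneg (by linarith) (by positivity)
  have hCs : ∀ k k', k ≠ k' → s k ≠ 0 → C k k' * s k' = (2 * (s k + s k') - S) / (2 * s k) := by
    intro k k' hk hsk
    simp only [hC, if_neg hk]
    -- For an empty-weight group division by zero makes `C` vanish; this is consistent, since then
    -- `s k` is exactly `S / 2` and the right side is zero as well.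
    by_cases hk' : s k' = 0
    · have h1 := hpair k k' hk
      have h2 := hg k
      change 2 * s k ≤ S at h2
      rw [hk'] at h1 ⊢
      rw [mul_zero, show 2 * (s k + 0) - S = 0 by linarith, zero_div]
    · field_simp
  have hrow : ∀ k, s k ≠ 0 → ∑ k', C k k' * s k' = 1 := by
    intro k hk
    have hd : ∀ k, C k k = 0 := fun k => if_pos rfl
    rw [Fin.sum_univ_three]
    fin_cases k
    · simp only [Fin.zero_eta] at hk ⊢
      rw [hd, hCs 0 1 (by decide) hk, hCs 0 2 (by decide) hk, ← hsS]
      field_simp; ring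
    · simp only [Fin.mk_one] at hk ⊢
      rw [hd, hCs 1 0 (by decide) hk, hCs 1 2 (by decide) hk, ← hsS]
      field_simp; ring
    · simp only [Fin.reduceFinMk] at hk ⊢
      rw [hd, hCs 2 0 (by decide) hk, hCs 2 1 (by decide) hk, ← hsS]
      field_simp; ring
  refine ⟨fun i j => C (g i) (g j) * l i * l j, ?_, ?_, ?_, ?_⟩
  · intro i j
    have := hC0 (g i) (g j)
    have := h0 i
    have := h0 j
    positivity
  · intro i
    simp [hC]
  · intro i j
    have : C (g i) (g j) = C (g j) (g i) := by
      simp only [hC, eq_comm (a := g i)]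
      split_ifs
      · rfl
      · congr 1 <;> ring
    simp only [this]
    ring
  · intro i
    have e : ∑ j, C (g i) (g j) * l i * l j = l i * ∑ k', C (g i) k' * s k' := by
      rw [← Finset.sum_fiberwise Finset.univ g, Finset.mul_sum]
      refine Finset.sum_congr rfl fun k _ => ?_
      rw [hs, Finset.mul_sum, Finset.mul_sum]
      refine Finset.sum_congr rfl fun j hj => ?_
      rw [(Finset.mem_filter.1 hj).2]
      ring
    rw [e]
    by_cases hi : s (g i) = 0
    · have : l i ≤ s (g i) :=
        Finset.single_le_sum (f := l) (fun j _ => h0 j) (Finset.mem_filter.2 ⟨Finset.mem_univ i, rfl⟩)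
      have : l i = 0 := le_antisymm (by linarith) (h0 i)
      rw [this, zero_mul]
    · rw [hrow _ hi, mul_one]

/-- Capping the largest entry of `l` so that no entry exceeds half of the sum. -/
theorem exists_capped {b : Type} [Fintype b] [DecidableEq b] (l : b → ℝ) (h0 : ∀ i, 0 ≤ l i)
    (L : ℝ) (hL : ∀ i, l i ≤ L) (hm : ∃ m, l m = L) :
    ∃ l' : b → ℝ, (∀ i, 0 ≤ l' i) ∧ (∀ i, l' i ≤ l i) ∧
      ∑ i, l' i = min (∑ i, l i) (2 * (∑ i, l i - L)) ∧ ∀ i, 2 * l' i ≤ ∑ j, l' j := by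
  obtain ⟨m, rfl⟩ := hm
  have hsplit : ∀ f : b → ℝ, ∑ i, f i = f m + ∑ i ∈ Finset.univ.erase m, f i := fun f =>
    (Finset.add_sum_erase _ f (Finset.mem_univ m)).symm
  have hle : ∀ i, i ≠ m → l i ≤ ∑ i ∈ Finset.univ.erase m, l i := fun i hi =>
    Finset.single_le_sum (f := l) (fun j _ => h0 j) (by simpa using hi)
  set R := ∑ i ∈ Finset.univ.erase m, l i with hR
  have hR0 : 0 ≤ R := Finset.sum_nonneg fun j _ => h0 j
  -- `R` is the sum of the other entries, so the capped entry is at most half of the new total; any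
  -- other entry is at most both `l m` and `R`.
  have hsum : ∑ i, Function.update l m (min (l m) R) i = min (l m) R + R := by
    rw [hsplit, Function.update_self]
    congr 1
    refine Finset.sum_congr rfl fun i hi => ?_
    rw [Function.update_of_ne (Finset.ne_of_mem_erase hi)]
  refine ⟨Function.update l m (min (l m) R), fun i => ?_, fun i => ?_, ?_, fun i => ?_⟩
  · by_cases hi : i = m
    · subst hi; simp [h0, hR0]
    · simp [hi, h0]
  · by_cases hi : i = m
    · subst hi; simp
    · simp [hi]
  · rw [hsum, hsplit l]
    rcases le_total (l m) R with h | h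
    · rw [min_eq_left h, min_eq_left (by linarith)]
    · rw [min_eq_right h, min_eq_right (by linarith)]
      ring
  · rw [hsum]
    by_cases hi : i = m
    · subst hi
      rw [Function.update_self]
      linarith [min_le_right (l i) R]
    · rw [Function.update_of_ne hi]
      linarith [hle i hi, le_min (hL i) (hle i hi)]

/-! ### Protocols -/

theorem eq_of_coeffMatrix_eq {a b : Type} {ψ φ : EuclideanSpace ℂ (a × b)}
    (h : coeffMatrix ψ = coeffMatrix φ) : ψ = φ := by
  ext ⟨i, j⟩
  exact congrFun (congrFun h j) i

theorem coeffMatrix_smul {a b : Type} (r : ℂ) (ψ : EuclideanSpace ℂ (a × b)) :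
    coeffMatrix (r • ψ) = r • coeffMatrix ψ := rfl

theorem sum_schmidtSq {a b : Type} [Fintype a] [Fintype b] [DecidableEq b]
    (ψ : EuclideanSpace ℂ (a × b)) : ∑ i, schmidtSq ψ i = ‖ψ‖ ^ 2 := by
  apply Complex.ofReal_injective
  rw [← trace_pureOp, trace_pureOp_eq_coeff, trace_mul_comm]
  have := (reducedBob_isHermitian ψ).trace_eq_sum_eigenvalues
  push_cast
  exact this.symm

section Protocols

variable {a b c d : Type} [Fintype a] [DecidableEq a] [Fintype b] [DecidableEq b]
  [Fintype c] [DecidableEq c] [Fintype d] [DecidableEq d]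

theorem pureOp_smul {n : Type} (r : ℝ) (φ : EuclideanSpace ℂ n) :
    pureOp ((r : ℂ) • φ) = ((r ^ 2 : ℝ) : ℂ) • pureOp φ := by
  ext i j
  simp [pureOp]
  ring

theorem sq_mem_conversionProbs_smul (r : ℝ) (φ : EuclideanSpace ℂ (c × d)) :
    r ^ 2 ∈ conversionProbs ((r : ℂ) • φ) φ :=
  ⟨_, LOCC.accept, pureOp_smul r φ⟩

theorem zero_mem_conversionProbs (ψ : EuclideanSpace ℂ (a × b)) (φ : EuclideanSpace ℂ (c × d)) :
    0 ∈ conversionProbs ψ φ :=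
  ⟨_, LOCC.abort, by simp⟩

theorem exists_conjTranspose_mul_self {A : Matrix b b ℂ} (hA : A.PosSemidef) :
    ∃ B : Matrix b b ℂ, A = Bᴴ * B := by
  open scoped MatrixOrder in
  exact CStarAlgebra.nonneg_iff_eq_star_mul_self.1 (Matrix.nonneg_iff_posSemidef.2 hA)

theorem conjTranspose_vecMulVec_mul_vecMulVec {m n l : Type} [Fintype m] (f g : m → ℂ)
    (x : n → ℂ) (y : l → ℂ) :
    (vecMulVec f x)ᴴ * vecMulVec g y = (star f ⬝ᵥ g) • vecMulVec (star x) y := by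
  rw [conjTranspose_vecMulVec, vecMulVec_mul_vecMulVec, vecMulVec_smul]

/-- The missing outcome of a subnormalised family of Kraus operators can be split into operators
with values in any given nontrivial register. -/
theorem exists_completion {b' ι : Type} [Fintype b'] [Fintype ι] (K : ι → Matrix b' b ℂ)
    (hK : (1 - ∑ i, (K i)ᴴ * K i).PosSemidef) (g : b' → ℂ) (hg : star g ⬝ᵥ g = 1) :
    ∃ R : b → Matrix b' b ℂ, ∑ i, (K i)ᴴ * K i + ∑ j, (R j)ᴴ * R j = 1 := by
  obtain ⟨B, hB⟩ := exists_conjTranspose_mul_self hK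
  -- Each row of `B` is sent to the same unit vector `g`, so the Gram matrices add up to `Bᴴ * B`.
  refine ⟨fun j => vecMulVec g (B j), ?_⟩
  have : ∑ j, (vecMulVec g (B j))ᴴ * vecMulVec g (B j) = Bᴴ * B := by
    simp only [conjTranspose_vecMulVec_mul_vecMulVec, hg, one_smul]
    ext i j
    simp [Matrix.sum_apply, mul_apply, vecMulVec_apply]
  rw [this, ← hB]
  abel

/-- Bob applies a subnormalised family of Kraus operators; the missing outcome aborts. -/
theorem sum_mem_conversionProbs_bob {b' ι : Type} [Fintype b'] [DecidableEq b'] [Fintype ι]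
    {ψ : EuclideanSpace ℂ (a × b)} {φ : EuclideanSpace ℂ (c × d)} (K : ι → Matrix b' b ℂ)
    (hK : (1 - ∑ i, (K i)ᴴ * K i).PosSemidef) (g : b' → ℂ) (hg : star g ⬝ᵥ g = 1) {p : ι → ℝ}
    (hp : ∀ i, p i ∈ conversionProbs (actBob (K i) ψ) φ) :
    ∑ i, p i ∈ conversionProbs ψ φ := by
  obtain ⟨R, hR⟩ := exists_completion K hK g hg
  choose F hF hFp using hp
  refine ⟨_, LOCC.bob (ι := ι ⊕ b) (κ := fun _ => Unit) (b' := fun _ => b')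
    (fun s _ => Sum.elim K R s) (by simpa using hR)
    (Sum.elim F fun _ _ => 0) (by rintro (i | j); exacts [hF i, LOCC.abort]), ?_⟩
  simp [onBob_pureOp, hFp, Finset.sum_smul]

theorem sum_mem_conversionProbs_alice {a' ι : Type} [Fintype a'] [DecidableEq a'] [Fintype ι]
    {ψ : EuclideanSpace ℂ (a × b)} {φ : EuclideanSpace ℂ (c × d)} (K : ι → Matrix a' a ℂ)
    (hK : (1 - ∑ i, (K i)ᴴ * K i).PosSemidef) (f : a' → ℂ) (hf : star f ⬝ᵥ f = 1) {p : ι → ℝ}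
    (hp : ∀ i, p i ∈ conversionProbs (actAlice (K i) ψ) φ) :
    ∑ i, p i ∈ conversionProbs ψ φ := by
  obtain ⟨R, hR⟩ := exists_completion K hK f hf
  choose F hF hFp using hp
  refine ⟨_, LOCC.alice (ι := ι ⊕ a) (κ := fun _ => Unit) (a' := fun _ => a')
    (fun s _ => Sum.elim K R s) (by simpa using hR)
    (Sum.elim F fun _ _ => 0) (by rintro (i | j); exacts [hF i, LOCC.abort]), ?_⟩
  simp [onAlice_pureOp, hFp, Finset.sum_smul]

/-- Bessel's inequality as an operator inequality. -/
theorem posSemidef_one_sub_sum {n m : Type} [Fintype n] [Fintype m] [DecidableEq m]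
    {v : n → EuclideanSpace ℂ m} (hv : Orthonormal ℂ v) {r : n → ℝ}
    (h1 : ∀ i, r i ≤ 1) :
    (1 - ∑ i, (r i : ℂ) • vecMulVec (v i).ofLp (star (v i).ofLp)).PosSemidef := by
  refine PosSemidef.of_dotProduct_mulVec_nonneg ?_ fun x => ?_
  · refine IsHermitian.sub isHermitian_one ?_
    simp [IsHermitian, conjTranspose_sum, conjTranspose_smul, conjTranspose_vecMulVec]
  · have hb := hv.sum_inner_products_le (WithLp.toLp 2 x) (s := Finset.univ)
    have e : star x ⬝ᵥ ((1 - ∑ i, (r i : ℂ) • vecMulVec (v i).ofLp (star (v i).ofLp)) *ᵥ x) =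
        ((‖WithLp.toLp 2 x‖ ^ 2 - ∑ i, r i * ‖inner ℂ (v i) (WithLp.toLp 2 x)‖ ^ 2 : ℝ) : ℂ) := by
      have hin : ∀ i, inner ℂ (v i) (WithLp.toLp 2 x) = star (v i).ofLp ⬝ᵥ x := fun i => by
        rw [EuclideanSpace.inner_eq_star_dotProduct, dotProduct_comm]
      rw [sub_mulVec, one_mulVec, dotProduct_sub, sum_mulVec, dotProduct_sum]
      push_cast
      congr 1
      · rw [← Complex.ofReal_pow, norm_sq_eq_sum]
        simp [dotProduct, Complex.conj_mul']
      · refine Finset.sum_congr rfl fun i _ => ?_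
        rw [hin, smul_mulVec, vecMulVec_mulVec, dotProduct_smul, dotProduct_smul,
          ← star_star (star x ⬝ᵥ (v i).ofLp), ← star_dotProduct_star, star_star]
        simp [Complex.conj_mul']
    rw [e]
    norm_cast
    have : ∑ i, r i * ‖inner ℂ (v i) (WithLp.toLp 2 x)‖ ^ 2 ≤
        ∑ i, ‖inner ℂ (v i) (WithLp.toLp 2 x)‖ ^ 2 :=
      Finset.sum_le_sum fun i _ => mul_le_of_le_one_left (by positivity) (h1 i)
    linarith

/-- Orthonormality of the outputs `g` kills the cross terms. It reduces the normalisation of both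
parties' Kraus operators to Bessel's inequality. -/
theorem gram_sum_vecMulVec {k m n : Type} [Fintype k] [DecidableEq k] [Fintype m]
    {g : k → m → ℂ} (hg : ∀ i j, star (g i) ⬝ᵥ g j = if i = j then 1 else 0) (y : k → n → ℂ) :
    (∑ i, vecMulVec (g i) (y i))ᴴ * ∑ i, vecMulVec (g i) (y i) =
      ∑ i, vecMulVec (star (y i)) (y i) := by
  simp only [conjTranspose_sum, Matrix.sum_mul, Matrix.mul_sum,
    conjTranspose_vecMulVec_mul_vecMulVec, hg, ite_smul, one_smul, zero_smul]
  simp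

/-- Alice maps her orthonormal Schmidt vectors `w k` to `f k`. -/
theorem sq_mem_conversionProbs_of_schmidt {k : Type} [Fintype k] [DecidableEq k] [Nonempty k]
    {f : k → c → ℂ} (hf : ∀ i j, star (f i) ⬝ᵥ f j = if i = j then 1 else 0) {g : k → d → ℂ}
    {w : k → EuclideanSpace ℂ a} (hw : Orthonormal ℂ w) {ψ : EuclideanSpace ℂ (a × d)}
    {φ : EuclideanSpace ℂ (c × d)} {r : ℝ} {t : ℂ}
    (hψ : coeffMatrix ψ = ((r : ℂ) * t) • ∑ i, vecMulVec (g i) (w i).ofLp)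
    (hφ : coeffMatrix φ = t • ∑ i, vecMulVec (g i) (f i)) : r ^ 2 ∈ conversionProbs ψ φ := by
  -- Alice's operator is the partial isometry `w i ↦ f i`.
  have h1 : actAlice (∑ i, vecMulVec (f i) (star (w i).ofLp)) ψ = (r : ℂ) • φ := by
    apply eq_of_coeffMatrix_eq
    have hin : ∀ i j, (w i).ofLp ⬝ᵥ star (w j).ofLp = if i = j then 1 else 0 := by
      intro i j
      rw [← EuclideanSpace.inner_eq_star_dotProduct, orthonormal_iff_ite.1 hw]
      simp only [eq_comm]
    rw [coeffMatrix_actAlice, coeffMatrix_smul, hψ, hφ, smul_smul]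
    rw [Matrix.smul_mul]
    congr 1
    simp only [transpose_sum, transpose_vecMulVec, Matrix.sum_mul,
      Matrix.mul_sum, vecMulVec_mul_vecMulVec, hin, ite_smul, one_smul, zero_smul]
    refine Finset.sum_congr rfl fun i _ => ?_
    refine (Finset.sum_eq_single i (fun j _ hj => ?_) (by simp)).trans ?_
    · ext
      simp [hj, vecMulVec_apply]
    · simp
  have := sum_mem_conversionProbs_alice (ι := Unit) (ψ := ψ) (φ := φ) (p := fun _ => r ^ 2)
    (fun _ => ∑ i, vecMulVec (f i) (star (w i).ofLp)) ?_ (f (Classical.arbitrary k))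
    (by simp [hf]) fun _ => h1 ▸ sq_mem_conversionProbs_smul r φ
  · simpa using this
  · have := posSemidef_one_sub_sum hw (r := fun _ => 1) fun _ => le_rfl
    simpa [gram_sum_vecMulVec hf] using this

theorem star_eigenvectorBasis_dotProduct {A : Matrix b b ℂ} (hA : A.IsHermitian) (i j : b) :
    star (hA.eigenvectorBasis i).ofLp ⬝ᵥ (hA.eigenvectorBasis j).ofLp = if i = j then 1 else 0 := by
  rw [dotProduct_comm, ← EuclideanSpace.inner_eq_star_dotProduct]
  exact orthonormal_iff_ite.1 hA.eigenvectorBasis.orthonormal i j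

/-- The (normalised) Schmidt vector of Alice that belongs to Bob's eigenvector `i`. -/
def schmidtVec (ψ : EuclideanSpace ℂ (a × b)) (i : b) : EuclideanSpace ℂ a :=
  WithLp.toLp 2 (((√(schmidtSq ψ i))⁻¹ : ℂ) •
    (star ((reducedBob_isHermitian ψ).eigenvectorBasis i).ofLp ᵥ* coeffMatrix ψ))

/-- Moving the coefficient matrix across the inner product turns it into a matrix element of Bob's
reduced state between eigenvectors. -/
theorem inner_schmidtVec {a b : Type} [Fintype a] [Fintype b] [DecidableEq b]
    (ψ : EuclideanSpace ℂ (a × b)) {i j : b} (hi : schmidtSq ψ i ≠ 0) :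
    inner ℂ (schmidtVec ψ i) (schmidtVec ψ j) = if i = j then 1 else 0 := by
  set v := (reducedBob_isHermitian ψ).eigenvectorBasis with hv
  have h : star (v j).ofLp ᵥ* coeffMatrix ψ ⬝ᵥ star (star (v i).ofLp ᵥ* coeffMatrix ψ) =
      (schmidtSq ψ i : ℂ) * if j = i then 1 else 0 := by
    rw [star_vecMul, star_star, dotProduct_mulVec, vecMul_vecMul, ← dotProduct_mulVec]
    change star (v j).ofLp ⬝ᵥ (reducedBob ψ *ᵥ (v i).ofLp) = _
    rw [hv, (reducedBob_isHermitian ψ).mulVec_eigenvectorBasis, ← hv]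
    change star (v j).ofLp ⬝ᵥ ((schmidtSq ψ i) • (v i).ofLp) = _
    rw [dotProduct_smul, hv, star_eigenvectorBasis_dotProduct]
    simp
  rw [EuclideanSpace.inner_eq_star_dotProduct]
  simp only [schmidtVec, ← hv, star_smul, smul_dotProduct, dotProduct_smul, h]
  by_cases hij : i = j
  · subst hij
    have hs : (√(schmidtSq ψ i) : ℂ) ^ 2 = schmidtSq ψ i := by
      rw [← Complex.ofReal_pow, Real.sq_sqrt (schmidtSq_nonneg ψ i)]
    have hne : (√(schmidtSq ψ i) : ℂ) ≠ 0 := by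
      intro h0
      rw [h0] at hs
      exact hi (Complex.ofReal_eq_zero.1 (hs.symm.trans (by simp)))
    simp
    field_simp
    exact hs.symm
  · simp [hij, Ne.symm hij]

/-- A symmetric weight with row sums below the Schmidt coefficients yields a protocol. -/
theorem sum_weights_mem_conversionProbs {f : Fin 2 → c → ℂ}
    (hf : ∀ i j, star (f i) ⬝ᵥ f j = if i = j then 1 else 0) {g : Fin 2 → d → ℂ}
    (hg : ∀ i j, star (g i) ⬝ᵥ g j = if i = j then 1 else 0) {φ : EuclideanSpace ℂ (c × d)}
    (hφ : coeffMatrix φ = ((1 / √2 : ℝ) : ℂ) • ∑ i, vecMulVec (g i) (f i))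
    (ψ : EuclideanSpace ℂ (a × b)) {W : b → b → ℝ} (hW : ∀ i j, 0 ≤ W i j)
    (hd : ∀ i, W i i = 0) (hs : ∀ i j, W i j = W j i) (hr : ∀ i, ∑ j, W i j ≤ schmidtSq ψ i) :
    ∑ i, ∑ j, W i j ∈ conversionProbs ψ φ := by
  set v := (reducedBob_isHermitian ψ).eigenvectorBasis with hv
  set s : b → ℝ := fun i => (√(schmidtSq ψ i))⁻¹ with hsdef
  set y : b → b → Fin 2 → b := fun i j => ![i, j]
  -- The factors `s` cancel the Schmidt amplitudes, so the outcome `(i, j)` leaves `√(W i j)` times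
  -- a maximally entangled pair; `1 / √2` is the Bell normalisation.
  set K : b × b → Matrix d b ℂ := fun x => ((√(W x.1 x.2) * (1 / √2) : ℝ) : ℂ) •
    ∑ k, vecMulVec (g k) ((s (y x.1 x.2 k) : ℂ) • star (v (y x.1 x.2 k)).ofLp) with hK
  have hle : ∀ i j, W i j ≤ schmidtSq ψ i := fun i j =>
    (Finset.single_le_sum (fun j _ => hW i j) (Finset.mem_univ j)).trans (hr i)
  have key : ∀ x : b × b, W x.1 x.2 ∈ conversionProbs (actBob (K x) ψ) φ := by
    rintro ⟨i, j⟩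
    by_cases h0 : W i j = 0
    · simp only [h0]
      exact zero_mem_conversionProbs _ _
    have hij : i ≠ j := fun h => h0 (h ▸ hd i)
    have hpos : 0 < W i j := lt_of_le_of_ne (hW i j) (Ne.symm h0)
    have hi : schmidtSq ψ i ≠ 0 := (hpos.trans_le (hle i j)).ne'
    have hj : schmidtSq ψ j ≠ 0 := (hpos.trans_le (hs i j ▸ hle j i)).ne'
    have := sq_mem_conversionProbs_of_schmidt (ψ := actBob (K (i, j)) ψ) (φ := φ)
      (r := √(W i j)) (w := fun k => schmidtVec ψ (y i j k)) hf ?_ ?_ hφ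
    · rwa [Real.sq_sqrt (hW i j)] at this
    · rw [orthonormal_iff_ite]
      intro k l
      have hne : schmidtSq ψ (y i j k) ≠ 0 := by fin_cases k <;> simpa [y]
      rw [inner_schmidtVec ψ hne]
      fin_cases k <;> fin_cases l <;> simp [y, hij, Ne.symm hij]
    · rw [coeffMatrix_actBob, hK]
      simp only [Matrix.smul_mul, Matrix.sum_mul, vecMulVec_mul, Complex.ofReal_mul, schmidtVec,
        smul_vecMul, hsdef, Complex.ofReal_inv, ← hv]
  have := sum_mem_conversionProbs_bob K ?_ (g 0) (by simp [hg]) key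
  · rwa [Fintype.sum_prod_type] at this
  · have hP := posSemidef_one_sub_sum v.orthonormal
      (r := fun i => (∑ j, W i j) * s i ^ 2) fun i => by
        rw [hsdef, inv_pow, Real.sq_sqrt (schmidtSq_nonneg ψ i), ← div_eq_mul_inv]
        exact div_le_one_of_le₀ (hr i) (schmidtSq_nonneg ψ i)
    convert hP using 2
    have hKK : ∀ x : b × b, (K x)ᴴ * K x = ((W x.1 x.2 / 2 : ℝ) : ℂ) • ∑ k,
        ((s (y x.1 x.2 k) ^ 2 : ℝ) : ℂ) • vecMulVec (v (y x.1 x.2 k)).ofLp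
          (star (v (y x.1 x.2 k)).ofLp) := by
      intro x
      simp only [hK, conjTranspose_smul, Matrix.smul_mul, Matrix.mul_smul, gram_sum_vecMulVec hg,
        smul_smul]
      congr 1
      · simp only [Complex.star_def, Complex.conj_ofReal, ← Complex.ofReal_mul]
        congr 1
        have h1 := Real.mul_self_sqrt (hW x.1 x.2)
        have h2 := Real.mul_self_sqrt (zero_le_two (α := ℝ))
        field_simp
        nlinarith
      · refine Finset.sum_congr rfl fun k _ => ?_
        rw [star_smul, star_star, vecMulVec_smul, smul_vecMulVec, smul_smul]
        simp [sq]
    simp only [hKK, Fin.sum_univ_two, y, cons_val_zero, cons_val_one, Fintype.sum_prod_type,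
      smul_add, Finset.sum_add_distrib, smul_smul]
    -- Each index occurs as first and as second member of a pair. By symmetry of `W` the two halves
    -- agree, so eigenvector `i` gets the coefficient `(∑ j, W i j) * s i ^ 2`.
    have e2 : ∑ i, ∑ j, (((W i j / 2 : ℝ) : ℂ) * ((s j ^ 2 : ℝ) : ℂ)) •
        vecMulVec (v j).ofLp (star (v j).ofLp) = ∑ i, ∑ j, (((W i j / 2 : ℝ) : ℂ) *
          ((s i ^ 2 : ℝ) : ℂ)) • vecMulVec (v i).ofLp (star (v i).ofLp) := by
      rw [Finset.sum_comm]
      simp only [hs]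
    rw [e2, ← Finset.sum_add_distrib]
    refine Finset.sum_congr rfl fun i _ => ?_
    rw [← Finset.sum_smul, ← add_smul]
    congr 1
    push_cast
    rw [← Finset.sum_mul, ← Finset.sum_div]
    ring

theorem min_mem_conversionProbs [Nonempty b] {f : Fin 2 → c → ℂ}
    (hf : ∀ i j, star (f i) ⬝ᵥ f j = if i = j then 1 else 0) {g : Fin 2 → d → ℂ}
    (hg : ∀ i j, star (g i) ⬝ᵥ g j = if i = j then 1 else 0) {φ : EuclideanSpace ℂ (c × d)}
    (hφ : coeffMatrix φ = ((1 / √2 : ℝ) : ℂ) • ∑ i, vecMulVec (g i) (f i))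
    (ψ : EuclideanSpace ℂ (a × b)) :
    min (‖ψ‖ ^ 2) (2 * (‖ψ‖ ^ 2 - lambdaMax ψ)) ∈ conversionProbs ψ φ := by
  obtain ⟨l, hl0, hl, hlS, hlm⟩ := exists_capped (schmidtSq ψ) (schmidtSq_nonneg ψ) (lambdaMax ψ)
    (schmidtSq_le_lambdaMax ψ) (exists_eq_ciSup_of_finite (f := schmidtSq ψ))
  obtain ⟨W, hW, hd, hs, hr⟩ := exists_symmetric_weights l hl0 hlm
  have := sum_weights_mem_conversionProbs hf hg hφ ψ hW hd hs fun i => (hr i).trans_le (hl i)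
  simp only [hr, hlS, sum_schmidtSq] at this
  exact this

end Protocols

/-- With product junk the target still has two equal Schmidt terms, with vectors `|i⟩ ⊗ x` and `|i⟩
⊗ y`. -/
theorem min_mem_conversionProbs_bellWithJunk {a b ja jb : Type} [Fintype a] [DecidableEq a]
    [Fintype b] [DecidableEq b] [Nonempty b] [Fintype ja] [DecidableEq ja] [Fintype jb]
    [DecidableEq jb] (ψ : EuclideanSpace ℂ (a × b)) {x : EuclideanSpace ℂ ja}
    {y : EuclideanSpace ℂ jb} (hx : ‖x‖ = 1) (hy : ‖y‖ = 1) :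
    min (‖ψ‖ ^ 2) (2 * (‖ψ‖ ^ 2 - lambdaMax ψ)) ∈ conversionProbs ψ (bellWithJunk x y) := by
  have hort : ∀ {n : Type} [Fintype n] [DecidableEq n] {z : EuclideanSpace ℂ n}, ‖z‖ = 1 →
      ∀ i j : Fin 2, star (fun s : Fin 2 × n => if s.1 = i then z s.2 else 0) ⬝ᵥ
        (fun s : Fin 2 × n => if s.1 = j then z s.2 else 0) = if i = j then 1 else 0 := by
    intro n _ _ z hz i j
    have hz' : ∑ k, star (z k) * z k = 1 := by
      have := trace_pureOp z
      rw [hz] at this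
      simpa [trace, pureOp, mul_comm] using this
    simp only [dotProduct, Fintype.sum_prod_type, Pi.star_apply]
    rw [Finset.sum_eq_single i (fun k _ hk => by simp [hk]) (by simp)]
    by_cases hij : i = j
    · simpa [hij] using hz'
    · simp [hij]
  refine min_mem_conversionProbs (hort hx) (hort hy) ?_ ψ
  ext ⟨k, l⟩ ⟨k', l'⟩
  fin_cases k <;> fin_cases k' <;>
    simp [coeffMatrix, bellWithJunk, bell, vecMulVec_apply, mul_comm]

theorem isGreatest_bellProbs {a b : Type} [Fintype a] [DecidableEq a] [Fintype b] [DecidableEq b]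
    [Nonempty b] (ψ : EuclideanSpace ℂ (a × b)) :
    IsGreatest (bellProbs ψ) (min (‖ψ‖ ^ 2) (2 * (‖ψ‖ ^ 2 - lambdaMax ψ))) := by
  -- One-dimensional junk registers already attain the optimum.
  have hx : ‖(EuclideanSpace.single () 1 : EuclideanSpace ℂ Unit)‖ = 1 := by simp
  exact ⟨conversionProbs_bellWithJunk_subset ψ hx hx (min_mem_conversionProbs_bellWithJunk ψ hx hx),
    fun p hp => bellProbs_le hp⟩

theorem isGreatest_conversionProbs_bellWithJunk {a b ja jb : Type} [Fintype a] [DecidableEq a]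
    [Fintype b] [DecidableEq b] [Nonempty b] [Fintype ja] [DecidableEq ja] [Fintype jb]
    [DecidableEq jb] (ψ : EuclideanSpace ℂ (a × b)) {x : EuclideanSpace ℂ ja}
    {y : EuclideanSpace ℂ jb} (hx : ‖x‖ = 1) (hy : ‖y‖ = 1) :
    IsGreatest (conversionProbs ψ (bellWithJunk x y))
      (min (‖ψ‖ ^ 2) (2 * (‖ψ‖ ^ 2 - lambdaMax ψ))) :=
  ⟨min_mem_conversionProbs_bellWithJunk ψ hx hy,
    fun _ hp => bellProbs_le (conversionProbs_bellWithJunk_subset ψ hx hy hp)⟩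

/-! ### The link together with a further state -/

/-- The state `link θ ⊗ χ`. -/
def linkTensor {a b : Type} (θ : ℝ) (χ : EuclideanSpace ℂ (a × b)) :
    EuclideanSpace ℂ ((Fin 2 × a) × (Fin 2 × b)) :=
  WithLp.toLp 2 fun i => link θ (i.1.1, i.2.1) * χ (i.1.2, i.2.2)

theorem norm_sq_linkTensor {a b : Type} [Fintype a] [Fintype b] (θ : ℝ)
    (χ : EuclideanSpace ℂ (a × b)) : ‖linkTensor θ χ‖ ^ 2 = ‖χ‖ ^ 2 := by
  have h : ‖Complex.cos θ‖ ^ 2 + ‖Complex.sin θ‖ ^ 2 = 1 := by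
    rw [← Complex.ofReal_cos, ← Complex.ofReal_sin, Complex.norm_real, Complex.norm_real,
      Real.norm_eq_abs, Real.norm_eq_abs, sq_abs, sq_abs, Real.cos_sq_add_sin_sq]
  rw [norm_sq_eq_sum, norm_sq_eq_sum]
  simp only [Fintype.sum_prod_type, Fin.sum_univ_two, linkTensor, link, norm_mul, mul_pow]
  simp [← Finset.mul_sum, ← add_mul, h]

/-- The coefficient matrix is block diagonal, with blocks `cos θ` and `sin θ` times that of `χ`; the
cosine block dominates. -/
theorem lambdaMax_linkTensor {a b : Type} [Fintype a] [DecidableEq a] [Fintype b] [DecidableEq b]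
    {θ : ℝ} (h0 : 0 < Real.cos θ) (hθ : Real.sin θ ^ 2 ≤ Real.cos θ ^ 2)
    (χ : EuclideanSpace ℂ (a × b)) :
    lambdaMax (linkTensor θ χ) = Real.cos θ ^ 2 * lambdaMax χ := by
  rw [lambdaMax_eq_norm, lambdaMax_eq_norm]
  have hm : ∀ (u : Fin 2 × a → ℂ) (j : Fin 2) (y : b),
      ‖(coeffMatrix (linkTensor θ χ) *ᵥ u) (j, y)‖ ^ 2 =
      (if j = 0 then Real.cos θ ^ 2 else Real.sin θ ^ 2) *
        ‖(coeffMatrix χ *ᵥ fun x => u (j, x)) y‖ ^ 2 := by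
    intro u j y
    have : (coeffMatrix (linkTensor θ χ) *ᵥ u) (j, y) =
        ((if j = 0 then Real.cos θ else Real.sin θ : ℝ) : ℂ) *
          (coeffMatrix χ *ᵥ fun x => u (j, x)) y := by
      simp only [mulVec, dotProduct, coeffMatrix, of_apply, linkTensor, link,
        Fintype.sum_prod_type, Fin.sum_univ_two]
      fin_cases j <;> simp [Finset.mul_sum, mul_assoc]
    rw [this, norm_mul, mul_pow, Complex.norm_real, Real.norm_eq_abs, sq_abs]
    split_ifs <;> rfl
  apply le_antisymm
  · refine sq_l2_opNorm_le _ (by positivity) fun u => ?_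
    simp only [Fintype.sum_prod_type, hm, ← Finset.mul_sum, Fin.sum_univ_two, if_true,
      one_ne_zero, if_false, mul_add]
    have h1 := sum_sq_mulVec_le (coeffMatrix χ) fun x => u (0, x)
    have h2 := sum_sq_mulVec_le (coeffMatrix χ) fun x => u (1, x)
    rw [mul_assoc, mul_assoc]
    gcongr
  · rw [mul_comm, ← le_div_iff₀ (by positivity)]
    refine sq_l2_opNorm_le _ (by positivity) fun u => ?_
    -- Test vectors supported on the cosine block give the reverse inequality.
    have := sum_sq_mulVec_le (coeffMatrix (linkTensor θ χ)) fun x => if x.1 = 0 then u x.2 else 0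
    simp only [Fintype.sum_prod_type, hm, ← Finset.mul_sum, Fin.sum_univ_two, if_true,
      one_ne_zero, if_false] at this
    rw [div_mul_eq_mul_div, le_div_iff₀ (by positivity)]
    have h3 : ∑ y, ‖(coeffMatrix χ *ᵥ fun _ : a => (0 : ℂ)) y‖ ^ 2 = 0 := by
      simp [mulVec, dotProduct]
    rw [h3] at this
    simp at this
    linarith

theorem max_eq_half_sum_add_abs (x y : ℝ) : max x y = (x + y + |x - y|) / 2 := by
  rcases le_total x y with h | h
  · rw [max_eq_right h, abs_of_nonpos (by linarith)]
    ring
  · rw [max_eq_left h, abs_of_nonneg (by linarith)]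
    ring

/-- The largest eigenvalue of a `2 × 2` reduced state, by its trace and determinant. -/
theorem lambdaMax_eq_of_trace_det {a : Type} [Fintype a] [DecidableEq a]
    (χ : EuclideanSpace ℂ (a × Fin 2)) {t D : ℝ} (ht : (reducedBob χ).trace = t)
    (hD : (reducedBob χ).det = D) : lambdaMax χ = (t + √(t ^ 2 - 4 * D)) / 2 := by
  have h1 := (reducedBob_isHermitian χ).trace_eq_sum_eigenvalues
  have h2 := (reducedBob_isHermitian χ).det_eq_prod_eigenvalues
  rw [ht, Fin.sum_univ_two] at h1
  rw [hD, Fin.prod_univ_two] at h2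
  have h1' : t = schmidtSq χ 0 + schmidtSq χ 1 :=
    Complex.ofReal_injective (h1.trans (Complex.ofReal_add _ _).symm)
  have h2' : D = schmidtSq χ 0 * schmidtSq χ 1 :=
    Complex.ofReal_injective (h2.trans (Complex.ofReal_mul _ _).symm)
  have h3 : lambdaMax χ = max (schmidtSq χ 0) (schmidtSq χ 1) := by
    apply le_antisymm
    · refine ciSup_le fun j => ?_
      fin_cases j
      · exact le_max_left _ _
      · exact le_max_right _ _
    · exact max_le (schmidtSq_le_lambdaMax χ 0) (schmidtSq_le_lambdaMax χ 1)
  rw [h3, show t ^ 2 - 4 * D = (schmidtSq χ 0 - schmidtSq χ 1) ^ 2 by rw [h1', h2']; ring,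
    Real.sqrt_sq_eq_abs, h1', max_eq_half_sum_add_abs]

/-- An entry is bounded by the operator norm. This suffices for arbitrary measurements of the Bank,
where no eigenvalue has to be computed. -/
theorem sq_norm_le_lambdaMax {a b : Type} [Fintype a] [DecidableEq a] [Fintype b] [DecidableEq b]
    (ψ : EuclideanSpace ℂ (a × b)) (i : a) (j : b) : ‖ψ (i, j)‖ ^ 2 ≤ lambdaMax ψ := by
  rw [lambdaMax_eq_norm]
  have h := sum_sq_mulVec_le (coeffMatrix ψ) (Pi.single i 1)
  have h1 : ∑ k, ‖(Pi.single i 1 : a → ℂ) k‖ ^ 2 = 1 := by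
    rw [Finset.sum_eq_single i (fun k _ hk => by simp [hk]) (by simp)]
    simp
  rw [h1, mul_one] at h
  refine le_trans ?_ h
  refine le_trans (le_of_eq ?_) (Finset.single_le_sum (fun k _ => by positivity)
    (Finset.mem_univ j))
  simp [coeffMatrix]

theorem lambdaMax_smul {a b : Type} [Fintype a] [DecidableEq a] [Fintype b] [DecidableEq b]
    (r : ℂ) (ψ : EuclideanSpace ℂ (a × b)) : lambdaMax (r • ψ) = ‖r‖ ^ 2 * lambdaMax ψ := by
  rw [lambdaMax_eq_norm, lambdaMax_eq_norm, coeffMatrix_smul, norm_smul, mul_pow]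

/-! ### The Bank -/

/-- The resource state seen across `A' K | B'`. -/
def transferResource (Ω : EuclideanSpace ℂ (Fin 2 × Fin 2 × Fin 2)) :
    EuclideanSpace ℂ ((Fin 2 × Fin 2) × Fin 2) :=
  WithLp.toLp 2 fun i => Ω (i.1.1, i.2, i.1.2)

/-- The resource state on `A' | B'` after an outcome of the Bank's measurement. -/
def branchResource (Ω : EuclideanSpace ℂ (Fin 2 × Fin 2 × Fin 2)) (e : EuclideanSpace ℂ (Fin 2)) :
    EuclideanSpace ℂ (Fin 2 × Fin 2) :=
  WithLp.toLp 2 fun i => ∑ k, star (e k) * Ω (i.1, i.2, k)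

theorem transferState_eq (θ : ℝ) (Ω : EuclideanSpace ℂ (Fin 2 × Fin 2 × Fin 2)) :
    transferState θ Ω = linkTensor θ (transferResource Ω) := rfl

theorem bankBranch_eq (θ : ℝ) (Ω : EuclideanSpace ℂ (Fin 2 × Fin 2 × Fin 2))
    (e : EuclideanSpace ℂ (Fin 2)) :
    bankBranch θ Ω e = linkTensor θ (branchResource Ω e) := by
  ext i
  simp only [bankBranch, linkTensor, branchResource, Finset.mul_sum]
  exact Finset.sum_congr rfl fun k _ => by ring

theorem cos_pos_and_sin_sq_le {θ : ℝ} (h0 : 0 < θ) (h : θ ≤ Real.pi / 4) :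
    0 < Real.cos θ ∧ Real.sin θ ^ 2 ≤ Real.cos θ ^ 2 := by
  have hpi := Real.pi_pos
  refine ⟨Real.cos_pos_of_mem_Ioo ⟨by linarith, by linarith⟩, ?_⟩
  have := Real.cos_nonneg_of_mem_Icc (x := 2 * θ) ⟨by linarith, by linarith⟩
  rw [Real.cos_two_mul'] at this
  linarith

theorem bankState_of_branch {θ L : ℝ} {Ω : EuclideanSpace ℂ (Fin 2 × Fin 2 × Fin 2)}
    {e : EuclideanSpace ℂ (Fin 2)} (hn : ‖bankBranch θ Ω e‖ ^ 2 = 1 / 2)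
    (hL : lambdaMax (bankBranch θ Ω e) = L / 2) :
    lambdaMax (bankState θ Ω e) = L ∧
      IsGreatest (bellProbs (bankState θ Ω e)) (min 1 (2 * (1 - L))) := by
  have h2 : ‖(‖bankBranch θ Ω e‖⁻¹ : ℂ)‖ ^ 2 = 2 := by
    rw [norm_inv, inv_pow, Complex.norm_real, norm_norm, hn]
    norm_num
  have hl : lambdaMax (bankState θ Ω e) = L := by
    rw [bankState, lambdaMax_smul, h2, hL]
    ring
  have h1 : ‖bankState θ Ω e‖ ^ 2 = 1 := by
    rw [bankState, norm_smul, mul_pow, h2, hn]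
    norm_num
  refine ⟨hl, ?_⟩
  have := isGreatest_bellProbs (bankState θ Ω e)
  rwa [h1, hl] at this

theorem isGreatest_bankProbs_hadamard {θ L : ℝ} {Ω : EuclideanSpace ℂ (Fin 2 × Fin 2 × Fin 2)}
    (hn : ∀ m, ‖bankBranch θ Ω (hadamard m)‖ ^ 2 = 1 / 2)
    (hL : ∀ m, lambdaMax (bankBranch θ Ω (hadamard m)) = L / 2) :
    IsGreatest (bankProbs θ Ω hadamard) (min 1 (2 * (1 - L))) := by
  have hg : ∀ m, IsGreatest (bellProbs (bankBranch θ Ω (hadamard m)))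
      (min 1 (2 * (1 - L)) / 2) := by
    intro m
    have := isGreatest_bellProbs (bankBranch θ Ω (hadamard m))
    rw [hn, hL] at this
    rwa [← min_div_div_right zero_le_two, show 2 * (1 - L) / 2 = 2 * (1 / 2 - L / 2) by ring]
  constructor
  · refine ⟨fun _ => min 1 (2 * (1 - L)) / 2, fun m => (hg m).1, ?_⟩
    simp
    ring
  · rintro p ⟨q, hq, rfl⟩
    rw [Fin.sum_univ_two]
    linarith [(hg 0).2 (hq 0), (hg 1).2 (hq 1)]

theorem transferState_of_resource {θ L : ℝ} (h0 : 0 < θ) (hθ : θ ≤ Real.pi / 4)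
    {Ω : EuclideanSpace ℂ (Fin 2 × Fin 2 × Fin 2)} (hn : ‖transferResource Ω‖ ^ 2 = 1)
    (hL : lambdaMax (transferResource Ω) = L) :
    lambdaMax (transferState θ Ω) = Real.cos θ ^ 2 * L ∧
      IsGreatest (bellProbs (transferState θ Ω)) (min 1 (2 * (1 - Real.cos θ ^ 2 * L))) := by
  obtain ⟨hc, hs⟩ := cos_pos_and_sin_sq_le h0 hθ
  have hl : lambdaMax (transferState θ Ω) = Real.cos θ ^ 2 * L := by
    rw [transferState_eq, lambdaMax_linkTensor hc hs, hL]
  refine ⟨hl, ?_⟩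
  have := isGreatest_bellProbs (transferState θ Ω)
  rwa [hl, transferState_eq, norm_sq_linkTensor, hn] at this

/-! ### GHZ-class resources -/

theorem inv_sqrt_two_mul_self : ((√2 : ℝ) : ℂ)⁻¹ * ((√2 : ℝ) : ℂ)⁻¹ = 1 / 2 := by
  rw [← mul_inv, ← Complex.ofReal_mul, Real.mul_self_sqrt zero_le_two]
  norm_num

theorem norm_sq_branchResource_ghz (α β : ℝ) (e : EuclideanSpace ℂ (Fin 2)) :
    ‖branchResource (ghz α β) e‖ ^ 2 = α ^ 2 * ‖e 0‖ ^ 2 + β ^ 2 * ‖e 1‖ ^ 2 := by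
  rw [norm_sq_eq_sum]
  simp [Fintype.sum_prod_type, Fin.sum_univ_two, branchResource, ghz, mul_pow, mul_comm]

theorem norm_sq_hadamard (m k : Fin 2) : ‖hadamard m k‖ ^ 2 = 1 / 2 := by
  fin_cases m <;> fin_cases k <;> simp [hadamard]

theorem lambdaMax_branchResource_ghz {α β : ℝ} (hβ : 0 < β) (hαβ : β ≤ α)
    (h : α ^ 2 + β ^ 2 = 1) (m : Fin 2) :
    lambdaMax (branchResource (ghz α β) (hadamard m)) = α ^ 2 / 2 := by
  have e : reducedBob (branchResource (ghz α β) (hadamard m)) =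
      !![((α ^ 2 / 2 : ℝ) : ℂ), 0; 0, ((β ^ 2 / 2 : ℝ) : ℂ)] := by
    ext i j
    fin_cases m <;> fin_cases i <;> fin_cases j <;>
      simp [reducedBob, coeffMatrix, mul_apply, branchResource, ghz, hadamard,
        Fin.sum_univ_two] <;> first
      | linear_combination (α : ℂ) ^ 2 * inv_sqrt_two_mul_self
      | linear_combination (β : ℂ) ^ 2 * inv_sqrt_two_mul_self
  rw [lambdaMax_eq_of_trace_det (t := 1 / 2) (D := α ^ 2 * β ^ 2 / 4)]
  · rw [show (1 / 2 : ℝ) ^ 2 - 4 * (α ^ 2 * β ^ 2 / 4) = ((α ^ 2 - β ^ 2) / 2) ^ 2 by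
      rw [show (1 / 2 : ℝ) = (α ^ 2 + β ^ 2) / 2 by rw [h]]; ring,
      Real.sqrt_sq (by nlinarith)]
    linarith
  · rw [e, trace_fin_two_of, ← Complex.ofReal_add, ← h]
    congr 1
    ring
  · rw [e, det_fin_two_of]
    push_cast
    ring

theorem lambdaMax_transferResource_ghz {α β : ℝ} (hβ : 0 < β) (hαβ : β ≤ α)
    (h : α ^ 2 + β ^ 2 = 1) : lambdaMax (transferResource (ghz α β)) = α ^ 2 := by
  have e : reducedBob (transferResource (ghz α β)) =
      !![((α ^ 2 : ℝ) : ℂ), 0; 0, ((β ^ 2 : ℝ) : ℂ)] := by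
    ext i j
    fin_cases i <;> fin_cases j <;>
      simp [reducedBob, coeffMatrix, mul_apply, transferResource, ghz,
        Fin.sum_univ_two, Fintype.sum_prod_type, sq]
  rw [lambdaMax_eq_of_trace_det (t := 1) (D := α ^ 2 * β ^ 2)]
  · rw [show (1 : ℝ) ^ 2 - 4 * (α ^ 2 * β ^ 2) = (α ^ 2 - β ^ 2) ^ 2 by rw [← h]; ring,
      Real.sqrt_sq (by nlinarith)]
    linarith
  · rw [e, trace_fin_two_of, ← Complex.ofReal_add, h]
  · rw [e, det_fin_two_of]
    push_cast
    ring

theorem norm_sq_transferResource_ghz {α β : ℝ} (h : α ^ 2 + β ^ 2 = 1) :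
    ‖transferResource (ghz α β)‖ ^ 2 = 1 := by
  rw [norm_sq_eq_sum, ← h]
  simp [Fintype.sum_prod_type, Fin.sum_univ_two, transferResource, ghz]

theorem IsMeasurement.sum_norm_sq {ι : Type} [Fintype ι] {e : ι → EuclideanSpace ℂ (Fin 2)}
    (he : IsMeasurement e) (k : Fin 2) : ∑ m, ‖e m k‖ ^ 2 = 1 := by
  have h := congrFun (congrFun he k) k
  rw [Matrix.sum_apply, one_apply_eq] at h
  simp only [pureOp, of_apply, Complex.star_def, Complex.mul_conj'] at h
  exact_mod_cast h

/-- The `|00⟩` coefficient of a branch gives it a squared Schmidt coefficient of at least `α ^ 2 *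
‖e m 0‖ ^ 2`. Both bounds on `q m` are then linear in `‖e m 0‖ ^ 2` and `‖e m 1‖ ^ 2`, each of which
sums to one. -/
theorem bankProbs_ghz_le {θ α β : ℝ} (h0 : 0 < θ) (hθ : θ ≤ Real.pi / 4)
    (h : α ^ 2 + β ^ 2 = 1) {ι : Type} [Fintype ι] {e : ι → EuclideanSpace ℂ (Fin 2)}
    (he : IsMeasurement e) {p : ℝ} (hp : p ∈ bankProbs θ (ghz α β) e) :
    p ≤ min 1 (2 * (1 - α ^ 2 * Real.cos θ ^ 2)) := by
  obtain ⟨hc, hs⟩ := cos_pos_and_sin_sq_le h0 hθ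
  obtain ⟨q, hq, rfl⟩ := hp
  have hb : ∀ m, q m ≤ α ^ 2 * ‖e m 0‖ ^ 2 + β ^ 2 * ‖e m 1‖ ^ 2 ∧
      q m ≤ 2 * (α ^ 2 * ‖e m 0‖ ^ 2 + β ^ 2 * ‖e m 1‖ ^ 2 -
        Real.cos θ ^ 2 * (α ^ 2 * ‖e m 0‖ ^ 2)) := by
    intro m
    have h1 := bellProbs_le (hq m)
    rw [bankBranch_eq, norm_sq_linkTensor, lambdaMax_linkTensor hc hs,
      norm_sq_branchResource_ghz] at h1
    have h2 := sq_norm_le_lambdaMax (branchResource (ghz α β) (e m)) 0 0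
    have h3 : ‖branchResource (ghz α β) (e m) (0, 0)‖ ^ 2 = α ^ 2 * ‖e m 0‖ ^ 2 := by
      simp [branchResource, ghz, mul_pow, mul_comm]
    rw [h3] at h2
    refine ⟨h1.trans (min_le_left _ _), h1.trans ((min_le_right _ _).trans ?_)⟩
    gcongr
  refine le_min ?_ ?_
  · refine (Finset.sum_le_sum fun m _ => (hb m).1).trans (le_of_eq ?_)
    rw [Finset.sum_add_distrib, ← Finset.mul_sum, ← Finset.mul_sum, he.sum_norm_sq,
      he.sum_norm_sq]
    linarith
  · refine (Finset.sum_le_sum fun m _ => (hb m).2).trans (le_of_eq ?_)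
    rw [← Finset.mul_sum, Finset.sum_sub_distrib, Finset.sum_add_distrib, ← Finset.mul_sum,
      ← Finset.mul_sum, ← Finset.mul_sum, ← Finset.mul_sum, he.sum_norm_sq, he.sum_norm_sq]
    linear_combination 2 * h

/-! ### W-class resources -/

theorem norm_sq_branchResource_wState {α β γ : ℝ} (h : α ^ 2 + β ^ 2 + γ ^ 2 = 1) (m : Fin 2) :
    ‖branchResource (wState α β γ) (hadamard m)‖ ^ 2 = 1 / 2 := by
  rw [norm_sq_eq_sum, ← h]
  fin_cases m <;>
    simp [Fintype.sum_prod_type, Fin.sum_univ_two, branchResource, wState, hadamard, mul_pow] <;>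
    ring

theorem lambdaMax_branchResource_wState {α β γ : ℝ} (h : α ^ 2 + β ^ 2 + γ ^ 2 = 1) (m : Fin 2) :
    lambdaMax (branchResource (wState α β γ) (hadamard m)) =
      (1 + √(1 - 4 * β ^ 2 * γ ^ 2)) / 2 / 2 := by
  -- The outcome only changes the sign of the coherence, which the determinant does not see;
  -- subtracting its square cancels the `α` term and leaves `β ^ 2 * γ ^ 2 / 4`.
  set s : ℝ := if m = 0 then 1 else -1 with hs
  have hs2 : s ^ 2 = 1 := by rw [hs]; split_ifs <;> norm_num
  have e : reducedBob (branchResource (wState α β γ) (hadamard m)) =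
      !![(((α ^ 2 + γ ^ 2) / 2 : ℝ) : ℂ), ((s * α * β / 2 : ℝ) : ℂ);
        ((s * α * β / 2 : ℝ) : ℂ), ((β ^ 2 / 2 : ℝ) : ℂ)] := by
    ext i j
    fin_cases m <;> fin_cases i <;> fin_cases j <;>
      simp [reducedBob, coeffMatrix, mul_apply, branchResource, wState, hadamard,
        Fin.sum_univ_two, hs] <;> first
      | linear_combination ((α : ℂ) ^ 2 + (γ : ℂ) ^ 2) * inv_sqrt_two_mul_self
      | linear_combination (β : ℂ) ^ 2 * inv_sqrt_two_mul_self
      | linear_combination (α * β : ℂ) * inv_sqrt_two_mul_self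
      | linear_combination (-α * β : ℂ) * inv_sqrt_two_mul_self
  rw [lambdaMax_eq_of_trace_det (t := 1 / 2) (D := β ^ 2 * γ ^ 2 / 4)]
  · rw [show (1 / 2 : ℝ) ^ 2 - 4 * (β ^ 2 * γ ^ 2 / 4) = (1 - 4 * β ^ 2 * γ ^ 2) / 2 ^ 2 by ring,
      Real.sqrt_div' _ (by norm_num), Real.sqrt_sq zero_le_two]
    ring
  · rw [e, trace_fin_two_of, ← Complex.ofReal_add, ← h]
    congr 1
    ring
  · rw [e, det_fin_two_of]
    norm_cast
    linear_combination (-(α ^ 2 * β ^ 2 / 4)) * hs2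

theorem norm_sq_transferResource_wState {α β γ : ℝ} (h : α ^ 2 + β ^ 2 + γ ^ 2 = 1) :
    ‖transferResource (wState α β γ)‖ ^ 2 = 1 := by
  rw [norm_sq_eq_sum, ← h]
  simp [Fintype.sum_prod_type, Fin.sum_univ_two, transferResource, wState]
  ring

theorem lambdaMax_transferResource_wState {α β γ : ℝ} (h : α ^ 2 + β ^ 2 + γ ^ 2 = 1) :
    lambdaMax (transferResource (wState α β γ)) = max (β ^ 2) (1 - β ^ 2) := by
  have e : reducedBob (transferResource (wState α β γ)) =
      !![((α ^ 2 + γ ^ 2 : ℝ) : ℂ), 0; 0, ((β ^ 2 : ℝ) : ℂ)] := by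
    ext i j
    fin_cases i <;> fin_cases j <;>
      simp [reducedBob, coeffMatrix, mul_apply, transferResource, wState,
        Fin.sum_univ_two, Fintype.sum_prod_type, sq]
  rw [lambdaMax_eq_of_trace_det (t := 1) (D := (1 - β ^ 2) * β ^ 2)]
  · rw [show (1 : ℝ) ^ 2 - 4 * ((1 - β ^ 2) * β ^ 2) = (β ^ 2 - (1 - β ^ 2)) ^ 2 by ring,
      Real.sqrt_sq_eq_abs, max_eq_half_sum_add_abs]
    ring
  · rw [e, trace_fin_two_of, ← Complex.ofReal_add, ← h]
    congr 1
    ring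
  · rw [e, det_fin_two_of, ← h]
    push_cast
    ring

/-- Since `1 / cos θ ^ 2 = 1 + tan θ ^ 2`, the condition reads `√(1 - x) ≤ tan θ ^ 2`. Squaring is
legitimate for every `x`, because the root of a negative number is zero. -/
theorem min_eq_one_iff_tan {θ x : ℝ} (hc : 0 < Real.cos θ) :
    min 1 (2 - Real.cos θ ^ 2 * (1 + √(1 - x))) = 1 ↔ 1 - Real.tan θ ^ 4 ≤ x := by
  have hc2 : 0 < Real.cos θ ^ 2 := by positivity
  have h : Real.cos θ ^ 2 * (1 + Real.tan θ ^ 2) = 1 := by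
    rw [Real.tan_eq_sin_div_cos]
    field_simp
    exact Real.cos_sq_add_sin_sq θ
  rw [min_eq_left_iff]
  have h1 : 1 ≤ 2 - Real.cos θ ^ 2 * (1 + √(1 - x)) ↔ √(1 - x) ≤ Real.tan θ ^ 2 := by
    constructor
    · intro h'
      have : Real.cos θ ^ 2 * √(1 - x) ≤ Real.cos θ ^ 2 * Real.tan θ ^ 2 := by linarith
      exact le_of_mul_le_mul_left this hc2
    · intro h'
      have := mul_le_mul_of_nonneg_left h' hc2.le
      linarith
  rw [h1, Real.sqrt_le_left (by positivity)]
  constructor <;> intro h' <;> nlinarith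

end BellRestoration

end

theorem mainTheorem8 :
    -- arbitrary bipartite pure states
    (∀ (a b : Type) [Fintype a] [DecidableEq a] [Fintype b] [DecidableEq b]
      (ψ : EuclideanSpace ℂ (a × b)), ‖ψ‖ = 1 →
      IsGreatest (BellRestoration.bellProbs ψ)
        (min 1 (2 * (1 - BellRestoration.lambdaMax ψ))) ∧
      ∀ (ja jb : Type) [Fintype ja] [DecidableEq ja] [Fintype jb] [DecidableEq jb]
        (x : EuclideanSpace ℂ ja) (y : EuclideanSpace ℂ jb), ‖x‖ = 1 → ‖y‖ = 1 →
        IsGreatest (BellRestoration.conversionProbs ψ (BellRestoration.bellWithJunk x y))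
          (min 1 (2 * (1 - BellRestoration.lambdaMax ψ)))) ∧
    -- GHZ-class assistance
    (∀ θ α β : ℝ, 0 < θ → θ ≤ Real.pi / 4 → 0 < β → β ≤ α → α ^ 2 + β ^ 2 = 1 →
      -- Bank-measures model, each branch of the Hadamard measurement
      (∀ m : Fin 2,
        ‖BellRestoration.bankBranch θ (BellRestoration.ghz α β)
          (BellRestoration.hadamard m)‖ ^ 2 = 1 / 2 ∧
        BellRestoration.lambdaMax (BellRestoration.bankState θ (BellRestoration.ghz α β)
          (BellRestoration.hadamard m)) = α ^ 2 * Real.cos θ ^ 2 ∧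
        IsGreatest (BellRestoration.bellProbs (BellRestoration.bankState θ
            (BellRestoration.ghz α β) (BellRestoration.hadamard m)))
          (min 1 (2 * (1 - α ^ 2 * Real.cos θ ^ 2)))) ∧
      -- Bank-measures model, total probability; no other measurement of the Bank does better
      IsGreatest (BellRestoration.bankProbs θ (BellRestoration.ghz α β) BellRestoration.hadamard)
        (min 1 (2 * (1 - α ^ 2 * Real.cos θ ^ 2))) ∧
      (∀ (ι : Type) [Fintype ι] (e : ι → EuclideanSpace ℂ (Fin 2)),
        BellRestoration.IsMeasurement e →
        ∀ p ∈ BellRestoration.bankProbs θ (BellRestoration.ghz α β) e,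
          p ≤ min 1 (2 * (1 - α ^ 2 * Real.cos θ ^ 2))) ∧
      -- transfer model
      BellRestoration.lambdaMax (BellRestoration.transferState θ (BellRestoration.ghz α β)) =
        α ^ 2 * Real.cos θ ^ 2 ∧
      IsGreatest (BellRestoration.bellProbs
          (BellRestoration.transferState θ (BellRestoration.ghz α β)))
        (min 1 (2 * (1 - α ^ 2 * Real.cos θ ^ 2)))) ∧
    -- W-class assistance
    (∀ θ α β γ : ℝ, 0 < θ → θ ≤ Real.pi / 4 → 0 < α → 0 < β → 0 < γ →
      α ^ 2 + β ^ 2 + γ ^ 2 = 1 →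
      -- Bank-measures model, each branch of the Hadamard measurement
      (∀ m : Fin 2,
        ‖BellRestoration.bankBranch θ (BellRestoration.wState α β γ)
          (BellRestoration.hadamard m)‖ ^ 2 = 1 / 2 ∧
        BellRestoration.lambdaMax (BellRestoration.bankState θ (BellRestoration.wState α β γ)
          (BellRestoration.hadamard m)) =
            Real.cos θ ^ 2 * ((1 + √(1 - 4 * β ^ 2 * γ ^ 2)) / 2) ∧
        IsGreatest (BellRestoration.bellProbs (BellRestoration.bankState θ
            (BellRestoration.wState α β γ) (BellRestoration.hadamard m)))
          (min 1 (2 - Real.cos θ ^ 2 * (1 + √(1 - 4 * β ^ 2 * γ ^ 2))))) ∧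
      -- Bank-measures model, total probability with the Hadamard measurement
      IsGreatest (BellRestoration.bankProbs θ (BellRestoration.wState α β γ)
          BellRestoration.hadamard)
        (min 1 (2 - Real.cos θ ^ 2 * (1 + √(1 - 4 * β ^ 2 * γ ^ 2)))) ∧
      (min 1 (2 - Real.cos θ ^ 2 * (1 + √(1 - 4 * β ^ 2 * γ ^ 2))) = 1 ↔
        1 - Real.tan θ ^ 4 ≤ 4 * β ^ 2 * γ ^ 2) ∧
      -- transfer model
      BellRestoration.lambdaMax
          (BellRestoration.transferState θ (BellRestoration.wState α β γ)) =
        Real.cos θ ^ 2 * max (β ^ 2) (1 - β ^ 2) ∧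
      IsGreatest (BellRestoration.bellProbs
          (BellRestoration.transferState θ (BellRestoration.wState α β γ)))
        (min 1 (2 * (1 - Real.cos θ ^ 2 * max (β ^ 2) (1 - β ^ 2))))) := by
  refine ⟨?_, ?_, ?_⟩
  · intro a b _ _ _ _ ψ hψ
    -- A unit vector cannot live on an empty register.
    have : Nonempty b := by
      by_contra hb
      rw [not_nonempty_iff] at hb
      have h := BellRestoration.norm_sq_eq_sum ψ
      simp [hψ] at h
    refine ⟨?_, fun ja jb _ _ _ _ x y hx hy => ?_⟩
    · simpa only [hψ, one_pow] using BellRestoration.isGreatest_bellProbs ψ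
    · simpa only [hψ, one_pow] using
        BellRestoration.isGreatest_conversionProbs_bellWithJunk ψ hx hy
  · intro θ α β h0 hθ hβ hαβ h
    obtain ⟨hc, hs⟩ := BellRestoration.cos_pos_and_sin_sq_le h0 hθ
    have hn : ∀ m, ‖BellRestoration.bankBranch θ (BellRestoration.ghz α β)
        (BellRestoration.hadamard m)‖ ^ 2 = 1 / 2 := by
      intro m
      rw [BellRestoration.bankBranch_eq, BellRestoration.norm_sq_linkTensor,
        BellRestoration.norm_sq_branchResource_ghz, BellRestoration.norm_sq_hadamard,
        BellRestoration.norm_sq_hadamard, ← add_mul, h, one_mul]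
    have hL : ∀ m, BellRestoration.lambdaMax (BellRestoration.bankBranch θ
        (BellRestoration.ghz α β) (BellRestoration.hadamard m)) =
          α ^ 2 * Real.cos θ ^ 2 / 2 := by
      intro m
      rw [BellRestoration.bankBranch_eq, BellRestoration.lambdaMax_linkTensor hc hs,
        BellRestoration.lambdaMax_branchResource_ghz hβ hαβ h]
      ring
    have ht := BellRestoration.transferState_of_resource h0 hθ
      (BellRestoration.norm_sq_transferResource_ghz h)
      (BellRestoration.lambdaMax_transferResource_ghz hβ hαβ h)
    rw [mul_comm (Real.cos θ ^ 2)] at ht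
    exact ⟨fun m => ⟨hn m, BellRestoration.bankState_of_branch (hn m) (hL m)⟩,
      BellRestoration.isGreatest_bankProbs_hadamard hn hL,
      fun ι _ e he p hp => BellRestoration.bankProbs_ghz_le h0 hθ h he hp, ht⟩
  · intro θ α β γ h0 hθ _ _ _ h
    obtain ⟨hc, hs⟩ := BellRestoration.cos_pos_and_sin_sq_le h0 hθ
    have hn : ∀ m, ‖BellRestoration.bankBranch θ (BellRestoration.wState α β γ)
        (BellRestoration.hadamard m)‖ ^ 2 = 1 / 2 := by
      intro m
      rw [BellRestoration.bankBranch_eq, BellRestoration.norm_sq_linkTensor,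
        BellRestoration.norm_sq_branchResource_wState h]
    have hL : ∀ m, BellRestoration.lambdaMax (BellRestoration.bankBranch θ
        (BellRestoration.wState α β γ) (BellRestoration.hadamard m)) =
          Real.cos θ ^ 2 * ((1 + √(1 - 4 * β ^ 2 * γ ^ 2)) / 2) / 2 := by
      intro m
      rw [BellRestoration.bankBranch_eq, BellRestoration.lambdaMax_linkTensor hc hs,
        BellRestoration.lambdaMax_branchResource_wState h]
      ring
    have he : 2 - Real.cos θ ^ 2 * (1 + √(1 - 4 * β ^ 2 * γ ^ 2)) =
        2 * (1 - Real.cos θ ^ 2 * ((1 + √(1 - 4 * β ^ 2 * γ ^ 2)) / 2)) := by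
      ring
    have hiff := BellRestoration.min_eq_one_iff_tan (x := 4 * β ^ 2 * γ ^ 2) hc
    rw [he] at hiff ⊢
    exact ⟨fun m => ⟨hn m, BellRestoration.bankState_of_branch (hn m) (hL m)⟩,
      BellRestoration.isGreatest_bankProbs_hadamard hn hL, hiff,
      BellRestoration.transferState_of_resource h0 hθ
        (BellRestoration.norm_sq_transferResource_wState h)
        (BellRestoration.lambdaMax_transferResource_wState h)⟩
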